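/- Let $k$ be a field of characteristic $2$ (for instance $k=\mathbb{F}_2$). Let $\mathcal{G}=(\mathcal{P},\mathcal{L})$ be the complete quadrilateral, i.e. the Fischer space of $\mathrm{Sym}(4)$: its points are the six transpositions of $\mathrm{Sym}(4)$ and its four lines are the triples $\{d,e,ded\}$ of transpositions with $de$ of order $3$. For distinct points $x,y$ on a common line write $x\sim y$, and let $x\wedge y$ be the third point of that line. Let $A=M_k(\mathcal{G},1)$ be the nilpotent Matsuo algebra, i.e. the commutative non-associative $k$-algebra with basis $\mathcal{P}$ (so $\dim A=6$) and multiplication $x\cdot y=x+y+x\wedge y$ if $x\sim y$, and $x\cdot y=0$ if $x=y$ or $x\not\sim y$. Let $\mathrm{Ann}(A)=\{a\in A\mid ab=0 \text{ for all } b\in A\}$ and let $A'=A/\mathrm{Ann}(A)$. For each line $\ell\in\mathcal{L}$ let $s_\ell$ be the sum of the three points of $\ell$. View $A$ as a $\mathbb{Z}$-decomposition algebra by giving, for each $\ell\in\mathcal{L}$, the $\mathbb{Z}$-grading $A=A_0^\ell\oplus A_1^\ell$ (other degrees being zero), where $A_\varepsilon^\ell$ is the eigenspace of $\mathrm{ad}_{s_\ell}\colon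 b\mapsto s_\ell b$ for the eigenvalue $\varepsilon\in\{0,1\}$; view $A'$ as a $\mathbb{Z}$-decomposition algebra in the same way, using the images of the elements $s_\ell$ in $A'$. For a $\mathbb{Z}$-decomposition algebra $B$ with $\mathbb{Z}$-gradings $B=\bigoplus_{n\in\mathbb{Z}}B_n^i$ indexed by $i\in\mathcal{I}$, let $\mathrm{Aut}(B)$ be the group functor $R\mapsto \mathrm{Aut}_R(R\otimes_k B)$ on commutative $k$-algebras. For a commutative $k$-algebra $R$ and $\lambda\in R^\times$, let $\tau_{i,\lambda}\in\mathrm{Aut}(B)(R)$ be the automorphism that is multiplication by $\lambda^n$ on $R\otimes B_n^i$ for all $n$, and let $T_i\le\mathrm{Aut}(B)$ be given by $T_i(R)=\langle\tau_{i,\lambda}\mid\lambda\in R^\times\rangle$. The Miyamoto group $\mathrm{Miy}(B)$ is the algebraic group over $k$ generated by the tori $T_i$, i.e. the smallest closed subgroup of $\mathrm{Aut}(B)$ containing all $T_i$. Then, as algebraic groups over $k$ (i.e. as group functors on commutative $k$-algebras), $$\mathrm{Miy}(A)\;\cong\;\mathrm{Miy}(A')\;\cong\;\mathbb{G}_a^2\rtimes\mathbb{G}_m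 ,$$ where the action of $\mathbb{G}_m$ on $\mathbb{G}_a^2$ is given by multiplication: $\lambda\cdot(\alpha,\beta)=(\lambda\alpha,\lambda\beta)$. -/

import Mathlib

open CategoryTheory TensorProduct

universe u

set_option linter.unusedSectionVars false
set_option linter.unusedSimpArgs false

noncomputable section

namespace NilpotentMatsuo

/-! ### Partial triple systems, 3-transposition groups and Fischer spaces -/

/-- A partial triple system with point set `P`: a partial linear space (two distinct lines meet in
at most one point) all of whose lines have exactly three points. -/
structure PartialTripleSystem (P : Type*) where
  lines : Set (Finset P)
  card_eq_three : ∀ l ∈ lines, l.card = 3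
  eq_of_mem : ∀ l ∈ lines, ∀ m ∈ lines, ∀ p q : P, p ≠ q →
    p ∈ l → q ∈ l → p ∈ m → q ∈ m → l = m

namespace PartialTripleSystem

variable {P : Type*} (G : PartialTripleSystem P)

/-- Two distinct points are collinear if they lie on a common line. -/
def Collinear (x y : P) : Prop := x ≠ y ∧ ∃ l ∈ G.lines, x ∈ l ∧ y ∈ l

theorem Collinear.symm {G : PartialTripleSystem P} {x y : P} (h : G.Collinear x y) :
    G.Collinear y x :=
  ⟨h.1.symm, h.2.imp fun _ hl => ⟨hl.1, hl.2.2, hl.2.1⟩⟩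

theorem exists_third {x y : P} (h : G.Collinear x y) :
    ∃ z, z ≠ x ∧ z ≠ y ∧ ∃ l ∈ G.lines, x ∈ l ∧ y ∈ l ∧ z ∈ l := by
  classical
  obtain ⟨-, l, hl, hx, hy⟩ := h
  have h2 : ({x, y} : Finset P).card < l.card :=
    lt_of_le_of_lt Finset.card_le_two (by rw [G.card_eq_three l hl]; norm_num)
  obtain ⟨z, hz, hz'⟩ := Finset.exists_mem_notMem_of_card_lt_card h2
  simp only [Finset.mem_insert, Finset.mem_singleton, not_or] at hz'
  exact ⟨z, hz'.1, hz'.2, l, hl, hx, hy, hz⟩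

open Classical in
/-- The third point `x ∧ y` on the line through two collinear points `x`, `y`
(and, by convention, `x` if `x`, `y` are not collinear). -/
def third (x y : P) : P := if h : G.Collinear x y then (G.exists_third h).choose else x

theorem third_eq {x y z : P} (hxy : x ≠ y) (hzx : z ≠ x) (hzy : z ≠ y) {l : Finset P}
    (hl : l ∈ G.lines) (hx : x ∈ l) (hy : y ∈ l) (hz : z ∈ l) : G.third x y = z := by
  classical
  have h : G.Collinear x y := ⟨hxy, l, hl, hx, hy⟩
  rw [third, dif_pos h]
  obtain ⟨h1, h2, m, hm, hxm, hym, hwm⟩ := (G.exists_third h).choose_spec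
  set w := (G.exists_third h).choose
  obtain rfl := G.eq_of_mem l hl m hm x y hxy hx hy hxm hym
  by_contra hwz
  have h4 : ({x, y, z, w} : Finset P).card = 4 := by
    rw [Finset.card_insert_of_notMem, Finset.card_insert_of_notMem,
      Finset.card_insert_of_notMem, Finset.card_singleton]
    all_goals simp only [Finset.mem_insert, Finset.mem_singleton, not_or]
    · exact fun h => hwz h.symm
    · exact ⟨hzy.symm, h2.symm⟩
    · exact ⟨hxy, hzx.symm, h1.symm⟩
  have hsub : ({x, y, z, w} : Finset P) ⊆ l := by
    intro p hp
    simp only [Finset.mem_insert, Finset.mem_singleton] at hp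
    rcases hp with rfl | rfl | rfl | rfl <;> assumption
  have := Finset.card_le_card hsub
  rw [G.card_eq_three l hl] at this
  omega

theorem third_comm {x y : P} (h : G.Collinear x y) : G.third x y = G.third y x := by
  obtain ⟨z, h1, h2, l, hl, hx, hy, hz⟩ := G.exists_third h
  rw [G.third_eq h.1 h1 h2 hl hx hy hz, G.third_eq h.1.symm h2 h1 hl hy hx hz]

end PartialTripleSystem

/-- `(G, D)` is a 3-transposition group: `D` is a conjugacy class of involutions generating `G`,
and all products `d * e` with `d, e ∈ D` have (finite) order at most `3`. -/
structure IsThreeTranspositionGroup (G : Type*) [Group G] (D : Set G) : Prop where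
  conjClass : ∃ d, D = {g | IsConj d g}
  involution : ∀ d ∈ D, orderOf d = 2
  generates : Subgroup.closure D = ⊤
  order_pos : ∀ d ∈ D, ∀ e ∈ D, 0 < orderOf (d * e)
  order_le : ∀ d ∈ D, ∀ e ∈ D, orderOf (d * e) ≤ 3

section Fischer

variable {G : Type*} [Group G]

/-- `d, e, f` are the three involutions `d, e, d * e * d` of the group `⟨d, e⟩ ≅ Sym(3)`, where
`d` and `e` are involutions whose product has order `3`. -/
def IsSymTriple (d e f : G) : Prop := orderOf (d * e) = 3 ∧ f = d * e * d

theorem IsSymTriple.rotate {d e f : G} (hd : orderOf d = 2) (he : orderOf e = 2)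
    (h : IsSymTriple d e f) : IsSymTriple e f d ∧ IsSymTriple e d f ∧ d ≠ e ∧ f ≠ d ∧ f ≠ e := by
  obtain ⟨h3, rfl⟩ := h
  have hd2 : d * d = 1 := by rw [← pow_two, ← hd, pow_orderOf_eq_one]
  have he2 : e * e = 1 := by rw [← pow_two, ← he, pow_orderOf_eq_one]
  have hde : d * e * d * e * d * e = 1 := by
    have := pow_orderOf_eq_one (d * e)
    rw [h3] at this
    simpa [pow_succ, mul_assoc] using this
  have hinv : d * e * d = e * d * e := by
    have : d * e * d * (e * d * e) = 1 := by simpa [mul_assoc] using hde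
    have h' : (e * d * e)⁻¹ = e * d * e := by
      rw [inv_eq_iff_mul_eq_one]
      calc e * d * e * (e * d * e) = e * d * (e * e) * d * e := by group
        _ = e * (d * d) * e := by rw [he2]; group
        _ = 1 := by rw [hd2]; simpa using he2
    rw [eq_inv_of_mul_eq_one_left this, h']
  have hd' : d⁻¹ = d := inv_eq_of_mul_eq_one_left hd2
  have he' : e⁻¹ = e := inv_eq_of_mul_eq_one_left he2
  have hed : orderOf (e * d) = 3 := by
    rw [← h3, ← orderOf_inv (d * e), mul_inv_rev, hd', he']
  have hne : d ≠ e := by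
    rintro rfl
    rw [hd2, orderOf_one] at h3
    norm_num at h3
  have hne' : d * e ≠ 1 := by
    intro h
    rw [h, orderOf_one] at h3
    norm_num at h3
  refine ⟨⟨?_, ?_⟩, ⟨hed, hinv⟩, hne, ?_, ?_⟩
  · rw [hinv]
    have : e * (e * d * e) = d * e := by
      rw [← mul_assoc, ← mul_assoc, he2, one_mul]
    rw [this, h3]
  · rw [hinv, ← mul_assoc, ← mul_assoc, he2, one_mul, mul_assoc, he2, mul_one]
  · intro h
    apply hne
    have : d * e = 1 := mul_eq_right.mp h
    exact absurd this hne'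
  · intro h
    have : e * d = 1 := by
      rw [hinv] at h
      exact mul_eq_right.mp h
    rw [this, orderOf_one] at hed
    norm_num at hed

/-- The Fischer space of a 3-transposition group `(G, D)`: the points are the elements of `D`, the
lines are the triples of involutions in the subgroups `⟨d, e⟩ ≅ Sym(3)` with `d, e ∈ D` and
`d * e` of order `3`. -/
def fischerSpace {D : Set G} (hD : IsThreeTranspositionGroup G D) : PartialTripleSystem D where
  lines := {l | ∃ d e f : D, IsSymTriple (d : G) e f ∧ ∀ p, p ∈ l ↔ p = d ∨ p = e ∨ p = f}
  card_eq_three := by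
    classical
    rintro l ⟨d, e, f, h, hl⟩
    obtain ⟨-, -, h1, h2, h3⟩ := h.rotate (hD.involution d d.2) (hD.involution e e.2)
    have : l = {d, e, f} := by ext p; simp [hl]
    rw [this, Finset.card_eq_three]
    exact ⟨d, e, f, fun h => h1 (congrArg _ h), fun h => h2 (congrArg _ h).symm,
      fun h => h3 (congrArg _ h).symm, rfl⟩
  eq_of_mem := by
    have key : ∀ l : Finset D, (∃ d e f : D, IsSymTriple (d : G) e f ∧
        ∀ p, p ∈ l ↔ p = d ∨ p = e ∨ p = f) → ∀ p q : D, p ≠ q → p ∈ l → q ∈ l →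
        ∀ r, r ∈ l ↔ r = p ∨ r = q ∨ (r : G) = p * q * p := by
      rintro l ⟨d, e, f, h, hl⟩ p q hpq hp hq r
      have hd := hD.involution d d.2
      have he := hD.involution e e.2
      have hf := hD.involution f f.2
      obtain ⟨h1, h2, -⟩ := h.rotate hd he
      obtain ⟨h3, h4, -⟩ := h1.rotate he hf
      obtain ⟨-, h5, -⟩ := h3.rotate hf hd
      rw [hl] at hp hq ⊢
      rcases hp with rfl | rfl | rfl <;> rcases hq with rfl | rfl | rfl <;>
        first
        | exact absurd rfl hpq
        | (rw [← h.2, ← Subtype.ext_iff])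
        | (rw [← h1.2, ← Subtype.ext_iff]; tauto)
        | (rw [← h2.2, ← Subtype.ext_iff]; tauto)
        | (rw [← h3.2, ← Subtype.ext_iff]; tauto)
        | (rw [← h4.2, ← Subtype.ext_iff]; tauto)
        | (rw [← h5.2, ← Subtype.ext_iff]; tauto)
    intro l hl m hm p q hpq hpl hql hpm hqm
    ext r
    rw [key l hl p q hpq hpl hql r, key m hm p q hpq hpm hqm r]

end Fischer

/-! ### Nilpotent Matsuo algebras -/

section Matsuo

variable {P : Type*} (G : PartialTripleSystem P) (R : Type*) [CommRing R] (η : R)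

/-- The underlying free module, with basis the points, of the nilpotent Matsuo algebra
`M_R(G, η)`. -/
@[nolint unusedArguments]
def Matsuo (_G : PartialTripleSystem P) (R : Type*) [CommRing R] (_η : R) := P →₀ R

namespace Matsuo

instance : AddCommGroup (Matsuo G R η) := inferInstanceAs (AddCommGroup (P →₀ R))
instance : Module R (Matsuo G R η) := inferInstanceAs (Module R (P →₀ R))

/-- The basis of points. -/
def basis : Module.Basis P R (Matsuo G R η) := Finsupp.basisSingleOne

open Classical in
/-- The product of two points: `η (x + y + x ∧ y)` if `x`, `y` are collinear and `0` otherwise. -/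
def pointMul (x y : P) : Matsuo G R η :=
  if G.Collinear x y then
    η • (basis G R η x + basis G R η y + basis G R η (G.third x y)) else 0

theorem pointMul_comm (x y : P) : pointMul G R η x y = pointMul G R η y x := by
  classical
  unfold pointMul
  by_cases h : G.Collinear x y
  · rw [if_pos h, if_pos h.symm, G.third_comm h, add_comm (basis G R η x)]
  · rw [if_neg h, if_neg fun h' => h h'.symm]

/-- The bilinear extension of the product of points. -/
def mulHom : Matsuo G R η →ₗ[R] Matsuo G R η →ₗ[R] Matsuo G R η :=
  (basis G R η).constr R fun x => (basis G R η).constr R fun y => pointMul G R η x y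

instance : Mul (Matsuo G R η) := ⟨fun a b => mulHom G R η a b⟩

theorem mul_def (a b : Matsuo G R η) : a * b = mulHom G R η a b := rfl

theorem basis_mul_basis (x y : P) :
    basis G R η x * basis G R η y = pointMul G R η x y := by
  rw [mul_def, mulHom, Module.Basis.constr_basis, Module.Basis.constr_basis]

theorem mulHom_flip : (mulHom G R η).flip = mulHom G R η := by
  refine (basis G R η).ext fun x => (basis G R η).ext fun y => ?_
  rw [LinearMap.flip_apply, ← mul_def, ← mul_def, basis_mul_basis, basis_mul_basis, pointMul_comm]

instance : NonUnitalNonAssocCommRing (Matsuo G R η) where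
  left_distrib a b c := map_add (mulHom G R η a) b c
  right_distrib a b c := by simp [mul_def]
  zero_mul a := by simp [mul_def]
  mul_zero a := map_zero (mulHom G R η a)
  mul_comm a b := by
    rw [mul_def, mul_def, ← LinearMap.flip_apply, mulHom_flip]

instance : IsScalarTower R (Matsuo G R η) (Matsuo G R η) :=
  ⟨fun r a b => by simp [mul_def]⟩

instance : SMulCommClass R (Matsuo G R η) (Matsuo G R η) :=
  ⟨fun r a b => by simp [mul_def]⟩

/-- The line nilpotent: the sum of the points on a line. -/
def lineSum (l : Finset P) : Matsuo G R η := ∑ p ∈ l, basis G R η p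

end Matsuo

end Matsuo

/-! ### The annihilator and the reduced algebra -/

section Reduced

variable (k : Type*) (A : Type*) [CommRing k] [NonUnitalNonAssocCommRing A] [Module k A]
  [IsScalarTower k A A] [SMulCommClass k A A]

/-- `Ann(A) = {a ∈ A | a b = 0 for all b ∈ A}`. -/
def annihilator : Submodule k A where
  carrier := {a | ∀ b, a * b = 0}
  add_mem' ha hb c := by rw [add_mul, ha c, hb c, add_zero]
  zero_mem' b := zero_mul b
  smul_mem' r a ha b := by rw [smul_mul_assoc, ha b, smul_zero]

/-- The quotient algebra `A / Ann(A)`. -/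
def Reduced := A ⧸ annihilator k A

namespace Reduced

instance : AddCommGroup (Reduced k A) := inferInstanceAs (AddCommGroup (A ⧸ annihilator k A))
instance : Module k (Reduced k A) := inferInstanceAs (Module k (A ⧸ annihilator k A))

/-- The quotient map `A → A / Ann(A)`. -/
def mk : A →ₗ[k] Reduced k A := (annihilator k A).mkQ

theorem mk_surjective : Function.Surjective (mk k A) := (annihilator k A).mkQ_surjective

theorem mk_eq_zero {a : A} : mk k A a = 0 ↔ ∀ b, a * b = 0 :=
  Submodule.Quotient.mk_eq_zero (annihilator k A)

theorem mk_eq_mk {a b : A} : mk k A a = mk k A b ↔ ∀ c, a * c = b * c := by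
  rw [← sub_eq_zero, ← map_sub, mk_eq_zero]
  exact forall_congr' fun c => by rw [sub_mul, sub_eq_zero]

instance : Mul (Reduced k A) :=
  ⟨Quotient.map₂ (· * ·) fun a a' ha b b' hb => by
    have ha' := (mk_eq_mk k A).1 (Quotient.sound ha)
    have hb' := (mk_eq_mk k A).1 (Quotient.sound hb)
    have : a * b = a' * b' := by rw [ha' b, mul_comm, hb' a', mul_comm]
    rw [this]⟩

theorem mk_mul (a b : A) : mk k A (a * b) = mk k A a * mk k A b := rfl

instance : NonUnitalNonAssocCommRing (Reduced k A) where
  left_distrib a b c := by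
    obtain ⟨a, rfl⟩ := mk_surjective k A a
    obtain ⟨b, rfl⟩ := mk_surjective k A b
    obtain ⟨c, rfl⟩ := mk_surjective k A c
    simp only [← map_add, ← mk_mul, mul_add]
  right_distrib a b c := by
    obtain ⟨a, rfl⟩ := mk_surjective k A a
    obtain ⟨b, rfl⟩ := mk_surjective k A b
    obtain ⟨c, rfl⟩ := mk_surjective k A c
    simp only [← map_add, ← mk_mul, add_mul]
  zero_mul a := by
    obtain ⟨a, rfl⟩ := mk_surjective k A a
    rw [← map_zero (mk k A), ← mk_mul, zero_mul]
  mul_zero a := by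
    obtain ⟨a, rfl⟩ := mk_surjective k A a
    rw [← map_zero (mk k A), ← mk_mul, mul_zero]
  mul_comm a b := by
    obtain ⟨a, rfl⟩ := mk_surjective k A a
    obtain ⟨b, rfl⟩ := mk_surjective k A b
    rw [← mk_mul, ← mk_mul, mul_comm]

instance : IsScalarTower k (Reduced k A) (Reduced k A) where
  smul_assoc r a b := by
    obtain ⟨a, rfl⟩ := mk_surjective k A a
    obtain ⟨b, rfl⟩ := mk_surjective k A b
    simp only [smul_eq_mul, ← map_smul, ← mk_mul, smul_mul_assoc]

instance : SMulCommClass k (Reduced k A) (Reduced k A) where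
  smul_comm r a b := by
    obtain ⟨a, rfl⟩ := mk_surjective k A a
    obtain ⟨b, rfl⟩ := mk_surjective k A b
    simp only [smul_eq_mul, ← map_smul, ← mk_mul, mul_smul_comm]

end Reduced

end Reduced

/-! ### Decompositions graded by the integers -/

section Decomposition

/-- A `ℤ`-decomposition algebra structure on the `k`-algebra `A`, with index set `ι`: for every
`i : ι` a direct sum decomposition `A = ⨁ₙ Aⁱₙ` with `Aⁱₘ Aⁱₙ ⊆ Aⁱₘ₊ₙ`. -/
structure ZDecomposition (k A ι : Type*) [CommRing k] [NonUnitalNonAssocCommRing A]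
    [Module k A] where
  part : ι → ℤ → Submodule k A
  isInternal : ∀ i, DirectSum.IsInternal (part i)
  mul_mem : ∀ i m n, ∀ a ∈ part i m, ∀ b ∈ part i n, a * b ∈ part i (m + n)

variable {k : Type*} (A : Type*) [Field k] [NonUnitalNonAssocCommRing A] [Module k A]
  [IsScalarTower k A A] [SMulCommClass k A A]

/-- The eigenspace decomposition of `ad_s : b ↦ s * b`: the part of degree `0` is the eigenspace
for the eigenvalue `0`, the part of degree `1` is the eigenspace for the eigenvalue `1`,
and the other parts are zero. -/
def adPart (k : Type*) {A : Type*} [Field k] [NonUnitalNonAssocCommRing A] [Module k A]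
    [IsScalarTower k A A] [SMulCommClass k A A] (s : A) (n : ℤ) : Submodule k A :=
  if n = 0 then Module.End.eigenspace (LinearMap.mulLeft k s) 0
  else if n = 1 then Module.End.eigenspace (LinearMap.mulLeft k s) 1
  else ⊥

/-- The identities, for an element `s` of an algebra in characteristic `2`, which say that `ad_s` is
an idempotent operator whose eigenspaces obey the fusion law
`0 * 0 = {0}`, `0 * 1 = 1 * 0 = {1}`, `1 * 1 = ∅`. -/
structure EigenFusion {A : Type*} [NonUnitalNonAssocCommRing A] (s : A) : Prop where
  idem : ∀ u, s * (s * u) = s * u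
  one_one : ∀ u v, (s * u) * (s * v) = 0
  zero_one : ∀ u v, s * (u * (s * v)) = u * (s * v)
  zero_zero : ∀ u v, s * (u * v) = (s * u) * v + u * (s * v)

variable {A}

theorem mem_adPart_zero {s u : A} : u ∈ adPart k s 0 ↔ s * u = 0 := by
  rw [adPart, if_pos rfl, Module.End.mem_eigenspace_iff, LinearMap.mulLeft_apply, zero_smul]

theorem mem_adPart_one {s u : A} : u ∈ adPart k s 1 ↔ s * u = u := by
  rw [adPart, if_neg one_ne_zero, if_pos rfl, Module.End.mem_eigenspace_iff,
    LinearMap.mulLeft_apply, one_smul]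

theorem adPart_eq_bot {s : A} {n : ℤ} (h0 : n ≠ 0) (h1 : n ≠ 1) : adPart k s n = ⊥ := by
  rw [adPart, if_neg h0, if_neg h1]

theorem EigenFusion.isInternal {s : A} (h : EigenFusion s) : DirectSum.IsInternal (adPart k s) := by
  rw [DirectSum.isInternal_submodule_iff_iSupIndep_and_iSup_eq_top]
  constructor
  · rw [iSupIndep_def]
    intro n
    have key : Disjoint (adPart k s 0) (adPart k s 1) := by
      rw [Submodule.disjoint_def]
      intro u h0 h1
      rw [mem_adPart_zero] at h0
      rw [mem_adPart_one] at h1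
      rw [← h1, h0]
    by_cases h0 : n = 0
    · subst h0
      refine key.mono_right (iSup₂_le fun m hm => ?_)
      by_cases h1 : m = 1
      · rw [h1]
      · rw [adPart_eq_bot hm h1]; exact bot_le
    · by_cases h1 : n = 1
      · subst h1
        refine key.symm.mono_right (iSup₂_le fun m hm => ?_)
        by_cases h0 : m = 0
        · rw [h0]
        · rw [adPart_eq_bot h0 hm]; exact bot_le
      · rw [adPart_eq_bot h0 h1]; exact disjoint_bot_left
  · rw [eq_top_iff]
    intro u _
    have : u = (u - s * u) + s * u := by abel
    rw [this]
    refine add_mem (Submodule.mem_iSup_of_mem 0 ?_) (Submodule.mem_iSup_of_mem 1 ?_)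
    · rw [mem_adPart_zero, mul_sub, h.idem, sub_self]
    · rw [mem_adPart_one, h.idem]

theorem EigenFusion.mul_mem {s : A} (h : EigenFusion s) (m n : ℤ) (a : A) (ha : a ∈ adPart k s m)
    (b : A) (hb : b ∈ adPart k s n) : a * b ∈ adPart k s (m + n) := by
  have bot : ∀ {m : ℤ} {a : A}, a ∈ adPart k s m → m ≠ 0 → m ≠ 1 → a = 0 := by
    intro m a ha h0 h1
    rw [adPart_eq_bot h0 h1] at ha
    simpa using ha
  by_cases m0 : m = 0
  · subst m0
    rw [mem_adPart_zero] at ha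
    by_cases n0 : n = 0
    · subst n0
      rw [mem_adPart_zero] at hb
      rw [add_zero, mem_adPart_zero, h.zero_zero, ha, hb, zero_mul, mul_zero, add_zero]
    · by_cases n1 : n = 1
      · subst n1
        rw [mem_adPart_one] at hb
        rw [zero_add, mem_adPart_one, ← hb, h.zero_one]
      · rw [bot hb n0 n1, mul_zero]; exact zero_mem _
  · by_cases m1 : m = 1
    · subst m1
      rw [mem_adPart_one] at ha
      by_cases n0 : n = 0
      · subst n0
        rw [add_zero, mem_adPart_one, mul_comm a b, ← ha, h.zero_one]
      · by_cases n1 : n = 1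
        · subst n1
          rw [mem_adPart_one] at hb
          rw [← ha, ← hb, h.one_one]; exact zero_mem _
        · rw [bot hb n0 n1, mul_zero]; exact zero_mem _
    · rw [bot ha m0 m1, zero_mul]; exact zero_mem _

theorem EigenFusion.reduced {s : A} (h : EigenFusion s) : EigenFusion (Reduced.mk k A s) where
  idem u := by
    obtain ⟨u, rfl⟩ := Reduced.mk_surjective k A u
    simp only [← Reduced.mk_mul, h.idem]
  one_one u v := by
    obtain ⟨u, rfl⟩ := Reduced.mk_surjective k A u
    obtain ⟨v, rfl⟩ := Reduced.mk_surjective k A v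
    simp only [← Reduced.mk_mul, h.one_one, map_zero]
  zero_one u v := by
    obtain ⟨u, rfl⟩ := Reduced.mk_surjective k A u
    obtain ⟨v, rfl⟩ := Reduced.mk_surjective k A v
    simp only [← Reduced.mk_mul, h.zero_one]
  zero_zero u v := by
    obtain ⟨u, rfl⟩ := Reduced.mk_surjective k A u
    obtain ⟨v, rfl⟩ := Reduced.mk_surjective k A v
    simp only [← Reduced.mk_mul, h.zero_zero, map_add]

/-- The `ℤ`-decomposition algebra given by the eigenspace decompositions of a family `s`. -/
def adDecomposition (k : Type*) {A ι : Type*} [Field k] [NonUnitalNonAssocCommRing A] [Module k A]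
    [IsScalarTower k A A] [SMulCommClass k A A] (s : ι → A) (h : ∀ i, EigenFusion (s i)) :
    ZDecomposition k A ι where
  part i := adPart k (s i)
  isInternal i := (h i).isInternal
  mul_mem i := (h i).mul_mem

end Decomposition

/-! ### Group functors, closed subgroups and the automorphism group functor -/

section GroupFunctor

variable {k : Type u} [CommRing k]

/-- A closed subgroup `H` of a group functor `F`: a subgroup `H(R) ≤ F(R)` for every commutative
`k`-algebra `R`, functorial in `R`, such that the subfunctor `H` is closed: for each `g ∈ F(R)`,
the condition that (the image of) `g` lies in `H` is represented by a quotient `R / I` of `R`. -/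
structure ClosedSubgroup (F : CommAlgCat.{u} k ⥤ GrpCat.{u}) where
  points : ∀ R : CommAlgCat.{u} k, Subgroup (F.obj R)
  map_mem : ∀ {R S : CommAlgCat.{u} k} (φ : R ⟶ S) (g : F.obj R),
    g ∈ points R → (F.map φ).hom g ∈ points S
  closed : ∀ (R : CommAlgCat.{u} k) (g : F.obj R), ∃ I : Ideal R,
    ∀ (S : CommAlgCat.{u} k) (φ : R ⟶ S), (F.map φ).hom g ∈ points S ↔ ∀ r ∈ I, φ.hom r = 0

namespace ClosedSubgroup

/-- A closed subgroup, regarded as a group functor. -/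
def toFunctor {F : CommAlgCat.{u} k ⥤ GrpCat.{u}} (H : ClosedSubgroup F) :
    CommAlgCat.{u} k ⥤ GrpCat.{u} where
  obj R := GrpCat.of (H.points R)
  map {R S} φ := GrpCat.ofHom
    (((F.map φ).hom.comp (H.points R).subtype).codRestrict (H.points S)
      fun g => H.map_mem φ g g.2)
  map_id R := by
    refine GrpCat.hom_ext (MonoidHom.ext fun g => Subtype.ext ?_)
    exact congrArg (fun f => f.hom (Subtype.val g)) (F.map_id R)
  map_comp {R S T} φ ψ := by
    refine GrpCat.hom_ext (MonoidHom.ext fun g => Subtype.ext ?_)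
    exact congrArg (fun f => f.hom (Subtype.val g)) (F.map_comp φ ψ)

/-- The closed subgroup of `F` generated by a family `T` of subgroup functors: the smallest closed
subgroup containing all of them, i.e. the intersection of all closed subgroups containing them. -/
def generated {F : CommAlgCat.{u} k ⥤ GrpCat.{u}} {ι : Type*}
    (T : ι → ∀ R : CommAlgCat.{u} k, Subgroup (F.obj R)) : ClosedSubgroup F where
  points R := ⨅ H : {H : ClosedSubgroup F // ∀ i R, T i R ≤ H.points R}, H.1.points R
  map_mem φ g hg := by
    rw [Subgroup.mem_iInf] at hg ⊢
    exact fun H => H.1.map_mem φ g (hg H)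
  closed R g := by
    choose I hI using fun H : {H : ClosedSubgroup F // ∀ i R, T i R ≤ H.points R} =>
      H.1.closed R g
    refine ⟨⨆ H, I H, fun S φ => ?_⟩
    have hker : ∀ J : Ideal R, (∀ r ∈ J, φ.hom r = 0) ↔ J ≤ RingHom.ker φ.hom := fun J => Iff.rfl
    rw [Subgroup.mem_iInf, hker, iSup_le_iff]
    exact forall_congr' fun H => (hI H S φ).trans (hker _)

theorem le_generated {F : CommAlgCat.{u} k ⥤ GrpCat.{u}} {ι : Type*}
    (T : ι → ∀ R : CommAlgCat.{u} k, Subgroup (F.obj R)) (i : ι) (R : CommAlgCat.{u} k) :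
    T i R ≤ (generated T).points R :=
  le_iInf fun H => H.2 i R

theorem generated_le {F : CommAlgCat.{u} k ⥤ GrpCat.{u}} {ι : Type*}
    (T : ι → ∀ R : CommAlgCat.{u} k, Subgroup (F.obj R)) (H : ClosedSubgroup F)
    (hH : ∀ i R, T i R ≤ H.points R) (R : CommAlgCat.{u} k) :
    (generated T).points R ≤ H.points R :=
  iInf_le (fun H : {H : ClosedSubgroup F // ∀ i R, T i R ≤ H.points R} => H.1.points R) ⟨H, hH⟩

end ClosedSubgroup

/-- The action of `Rˣ` on `R²` by multiplication: `l • (α, β) = (l α, l β)`. -/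
def scaleAction (R : Type*) [CommRing R] : Rˣ →* MulAut (Multiplicative (R × R)) :=
  (MulAutMultiplicative (R × R)).symm.toMonoidHom.comp (DistribMulAction.toAddAut Rˣ (R × R))

theorem scaleAction_apply (R : Type*) [CommRing R] (l : Rˣ) (a b : R) :
    scaleAction R l (Multiplicative.ofAdd (a, b)) = Multiplicative.ofAdd (l * a, l * b) := rfl

variable (k) in
/-- The group functor `𝔾ₐ² ⋊ 𝔾ₘ`, where `𝔾ₘ` acts on `𝔾ₐ²` by multiplication:
`R ↦ R² ⋊ Rˣ`. -/
def gaSqGm : CommAlgCat.{u} k ⥤ GrpCat.{u} where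
  obj R := GrpCat.of (Multiplicative (R × R) ⋊[scaleAction R] Rˣ)
  map {R S} φ := GrpCat.ofHom (SemidirectProduct.map
    (AddMonoidHom.toMultiplicative ((φ.hom : R →+ S).prodMap (φ.hom : R →+ S)))
    (Units.map (φ.hom : R →* S)) fun l => MonoidHom.ext fun _ =>
      congrArg Multiplicative.ofAdd
        (Prod.ext (map_mul φ.hom (l : R) _) (map_mul φ.hom (l : R) _)))
  map_id _ := rfl
  map_comp _ _ := rfl

section Aut

variable (k) (A : Type u) [NonUnitalNonAssocCommRing A] [Module k A]
  [IsScalarTower k A A] [SMulCommClass k A A]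

/-- The group of `R`-algebra automorphisms of `R ⊗ A`, for a commutative `k`-algebra `R`. -/
def autPoints (R : Type u) [CommRing R] [Algebra k R] :
    Subgroup ((R ⊗[k] A) ≃ₗ[R] (R ⊗[k] A)) where
  carrier := {g | ∀ a b, g (a * b) = g a * g b}
  mul_mem' {g h} hg hh a b := by
    simp only [LinearEquiv.mul_apply]
    rw [hh, hg]
  one_mem' _ _ := rfl
  inv_mem' {g} hg a b := by
    apply g.injective
    rw [hg]
    simp only [← LinearEquiv.mul_apply, mul_inv_cancel, LinearEquiv.coe_one, id]

variable {k A}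

section BaseChange

variable {R S T : Type u} [CommRing R] [Algebra k R] [CommRing S] [Algebra k S]
  [CommRing T] [Algebra k T]

/-- The map `φ ⊗ id : R ⊗ A → S ⊗ A`. -/
def tensorMap (A : Type u) [NonUnitalNonAssocCommRing A] [Module k A] (φ : R →ₐ[k] S) :
    R ⊗[k] A →ₗ[k] S ⊗[k] A := LinearMap.rTensor A φ.toLinearMap

@[simp] theorem tensorMap_tmul (φ : R →ₐ[k] S) (r : R) (a : A) :
    tensorMap A φ (r ⊗ₜ a) = φ r ⊗ₜ a := rfl

theorem tensorMap_smul (φ : R →ₐ[k] S) (r : R) (x : R ⊗[k] A) :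
    tensorMap A φ (r • x) = φ r • tensorMap A φ x := by
  induction x with
  | zero => simp
  | tmul s a => simp [TensorProduct.smul_tmul']
  | add x y hx hy => rw [smul_add, map_add, hx, hy, map_add, smul_add]

theorem tensorMap_mul (φ : R →ₐ[k] S) (x y : R ⊗[k] A) :
    tensorMap A φ (x * y) = tensorMap A φ x * tensorMap A φ y := by
  induction x with
  | zero => simp
  | add x y hx hy => rw [add_mul, map_add, hx, hy, map_add, add_mul]
  | tmul s a =>
    induction y with
    | zero => simp
    | add x y hx hy => rw [mul_add, map_add, hx, hy, map_add, mul_add]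
    | tmul t b => simp

/-- The base change along `φ : R → S` of an `R`-linear endomorphism `g` of `R ⊗ A`:
the `S`-linear map with `s ⊗ a ↦ s • (φ ⊗ id) (g (1 ⊗ a))`. -/
def baseChangeEnd (φ : R →ₐ[k] S) (g : R ⊗[k] A →ₗ[R] R ⊗[k] A) : S ⊗[k] A →ₗ[S] S ⊗[k] A :=
  LinearMap.liftBaseChange S (tensorMap A φ ∘ₗ g.restrictScalars k ∘ₗ TensorProduct.mk k R A 1)

theorem baseChangeEnd_tmul (φ : R →ₐ[k] S) (g : R ⊗[k] A →ₗ[R] R ⊗[k] A) (s : S) (a : A) :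
    baseChangeEnd φ g (s ⊗ₜ a) = s • tensorMap A φ (g (1 ⊗ₜ a)) := by
  simp [baseChangeEnd]

theorem baseChangeEnd_tensorMap (φ : R →ₐ[k] S) (g : R ⊗[k] A →ₗ[R] R ⊗[k] A) (x : R ⊗[k] A) :
    baseChangeEnd φ g (tensorMap A φ x) = tensorMap A φ (g x) := by
  induction x with
  | zero => simp
  | add x y hx hy => simp only [map_add, hx, hy]
  | tmul r a =>
    rw [tensorMap_tmul, baseChangeEnd_tmul, ← tensorMap_smul, ← map_smul, TensorProduct.smul_tmul',
      smul_eq_mul, mul_one]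

theorem end_ext {g h : S ⊗[k] A →ₗ[S] S ⊗[k] A} (H : ∀ a : A, g (1 ⊗ₜ a) = h (1 ⊗ₜ a)) : g = h := by
  ext a
  simpa using H a

theorem baseChangeEnd_comp (φ : R →ₐ[k] S) (g h : R ⊗[k] A →ₗ[R] R ⊗[k] A) :
    baseChangeEnd φ (g ∘ₗ h) = baseChangeEnd φ g ∘ₗ baseChangeEnd φ h :=
  end_ext fun a => by
    rw [LinearMap.comp_apply, baseChangeEnd_tmul, baseChangeEnd_tmul, one_smul, one_smul,
      baseChangeEnd_tensorMap, LinearMap.comp_apply]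

theorem baseChangeEnd_one (φ : R →ₐ[k] S) :
    baseChangeEnd φ (LinearMap.id : R ⊗[k] A →ₗ[R] R ⊗[k] A) = LinearMap.id :=
  end_ext fun a => by simp [baseChangeEnd_tmul]

theorem baseChangeEnd_id (g : R ⊗[k] A →ₗ[R] R ⊗[k] A) :
    baseChangeEnd (AlgHom.id k R) g = g :=
  end_ext fun a => by
    rw [baseChangeEnd_tmul, one_smul]
    exact LinearMap.congr_fun (LinearMap.rTensor_id A R) _

theorem baseChangeEnd_baseChangeEnd (φ : R →ₐ[k] S) (ψ : S →ₐ[k] T)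
    (g : R ⊗[k] A →ₗ[R] R ⊗[k] A) :
    baseChangeEnd (ψ.comp φ) g = baseChangeEnd ψ (baseChangeEnd φ g) :=
  end_ext fun a => by
    rw [baseChangeEnd_tmul, baseChangeEnd_tmul, baseChangeEnd_tmul, one_smul, one_smul, one_smul]
    exact LinearMap.congr_fun (LinearMap.rTensor_comp A ψ.toLinearMap φ.toLinearMap) _

theorem baseChangeEnd_mul (φ : R →ₐ[k] S) (g : autPoints k A R) (x y : S ⊗[k] A) :
    baseChangeEnd φ g.1.toLinearMap (x * y) =
      baseChangeEnd φ g.1.toLinearMap x *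
        baseChangeEnd φ g.1.toLinearMap y := by
  induction x with
  | zero => simp
  | add x y hx hy => rw [add_mul, map_add, hx, hy, map_add, add_mul]
  | tmul s a =>
    induction y with
    | zero => simp
    | add x y hx hy => rw [mul_add, map_add, hx, hy, map_add, mul_add]
    | tmul t b =>
      have := g.2 (1 ⊗ₜ a) (1 ⊗ₜ b)
      rw [Algebra.TensorProduct.tmul_mul_tmul, one_mul] at this
      rw [Algebra.TensorProduct.tmul_mul_tmul]
      simp only [baseChangeEnd_tmul, LinearEquiv.coe_coe]
      rw [this, tensorMap_mul, smul_mul_assoc, mul_smul_comm, smul_smul]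

/-- The base change along `φ : R → S` of an `R`-linear automorphism of `R ⊗ A`. -/
def baseChangeEquiv (φ : R →ₐ[k] S) (g : (R ⊗[k] A) ≃ₗ[R] (R ⊗[k] A)) :
    (S ⊗[k] A) ≃ₗ[S] (S ⊗[k] A) :=
  LinearEquiv.ofLinearMap (baseChangeEnd φ g.toLinearMap) (baseChangeEnd φ g.symm.toLinearMap)
    (by rw [← baseChangeEnd_comp, LinearEquiv.comp_symm, baseChangeEnd_one])
    (by rw [← baseChangeEnd_comp, LinearEquiv.symm_comp, baseChangeEnd_one])

theorem baseChangeEquiv_apply (φ : R →ₐ[k] S) (g : (R ⊗[k] A) ≃ₗ[R] (R ⊗[k] A))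
    (x : S ⊗[k] A) : baseChangeEquiv φ g x = baseChangeEnd φ g.toLinearMap x := rfl

/-- The group homomorphism `Aut_R(R ⊗ A) → Aut_S(S ⊗ A)` given by base change along `φ`. -/
def autMap (φ : R →ₐ[k] S) : autPoints k A R →* autPoints k A S where
  toFun g := ⟨baseChangeEquiv φ g.1, fun x y => baseChangeEnd_mul φ g x y⟩
  map_one' := Subtype.ext <| LinearEquiv.ext fun x =>
    LinearMap.congr_fun (baseChangeEnd_one (A := A) φ) x
  map_mul' g h := Subtype.ext <| LinearEquiv.ext fun x =>
    LinearMap.congr_fun (baseChangeEnd_comp φ g.1.toLinearMap h.1.toLinearMap) x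

theorem autMap_apply (φ : R →ₐ[k] S) (g : autPoints k A R) (x : S ⊗[k] A) :
    (autMap φ g).1 x = baseChangeEnd φ g.1.toLinearMap x := rfl

theorem autMap_id : autMap (A := A) (AlgHom.id k R) = MonoidHom.id _ :=
  MonoidHom.ext fun g => Subtype.ext <| LinearEquiv.ext fun x =>
    LinearMap.congr_fun (baseChangeEnd_id g.1.toLinearMap) x

theorem autMap_comp (φ : R →ₐ[k] S) (ψ : S →ₐ[k] T) :
    autMap (A := A) (ψ.comp φ) = (autMap ψ).comp (autMap φ) :=
  MonoidHom.ext fun g => Subtype.ext <| LinearEquiv.ext fun x =>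
    LinearMap.congr_fun (baseChangeEnd_baseChangeEnd φ ψ g.1.toLinearMap) x

end BaseChange

variable (k A) in
/-- The automorphism group functor `Aut(A) : R ↦ Aut_R(R ⊗ A)` of a `k`-algebra `A`. -/
def autFunctor : CommAlgCat.{u} k ⥤ GrpCat.{u} where
  obj R := GrpCat.of (autPoints k A R)
  map φ := GrpCat.ofHom (autMap φ.hom)
  map_id _ := congrArg GrpCat.ofHom autMap_id
  map_comp φ ψ := congrArg GrpCat.ofHom (autMap_comp φ.hom ψ.hom)

/-! ### The Miyamoto group -/

variable {ι : Type*}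

/-- `g` is the Miyamoto map `τ_{i,λ}` on `R ⊗ A`, i.e. the `R`-linear automorphism which is
multiplication by `λⁿ` on the part `Aⁱₙ`, for all integers `n`. -/
def IsMiyamotoMap (D : ZDecomposition k A ι) (i : ι) {R : Type u} [CommRing R] [Algebra k R]
    (l : Rˣ) (g : autPoints k A R) : Prop :=
  ∀ n : ℤ, ∀ a ∈ D.part i n, g.1 ((1 : R) ⊗ₜ[k] a) = ((l ^ n : Rˣ) : R) • ((1 : R) ⊗ₜ[k] a)

/-- The torus `T_i`: its group of `R`-points is `⟨τ_{i,λ} | λ ∈ Rˣ⟩ ≤ Aut_R(R ⊗ A)`. -/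
def torus (D : ZDecomposition k A ι) (i : ι) (R : CommAlgCat.{u} k) :
    Subgroup ((autFunctor k A).obj R) :=
  Subgroup.closure {g : autPoints k A R | ∃ l : Rˣ, IsMiyamotoMap D i l g}

/-- The Miyamoto group `Miy(A, ι, D)`: the algebraic group generated by the tori `T_i`, that is,
the smallest closed subgroup of `Aut(A)` containing all of them. -/
def miyamotoGroup (D : ZDecomposition k A ι) : CommAlgCat.{u} k ⥤ GrpCat.{u} :=
  (ClosedSubgroup.generated (torus D)).toFunctor

end Aut

end GroupFunctor

/-! ### The complete quadrilateral -/

section Quadrilateral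

/-- The set of the six transpositions in `Sym(4)`. -/
def transpositions : Set (Equiv.Perm (Fin 4)) := {g | g.IsSwap}

theorem isThreeTranspositionGroup_transpositions :
    IsThreeTranspositionGroup (Equiv.Perm (Fin 4)) transpositions where
  conjClass := by
    refine ⟨Equiv.swap 0 1, ?_⟩
    ext g
    constructor
    · rintro ⟨x, y, hxy, rfl⟩
      exact Equiv.Perm.isConj_swap (by decide) hxy
    · intro h
      obtain ⟨c, rfl⟩ := isConj_iff.1 h
      exact ⟨c 0, c 1, by simp, (Equiv.swap_apply_apply c 0 1).symm⟩
  involution := by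
    rintro _ ⟨x, y, hxy, rfl⟩
    exact orderOf_eq_prime (by simp [pow_two]) (by simpa using hxy)
  generates := Equiv.Perm.closure_isSwap
  order_pos _ _ _ _ := orderOf_pos _
  order_le := by
    have key : ∀ x y z w : Fin 4,
        (Equiv.swap x y * Equiv.swap z w) ^ 2 = 1 ∨ (Equiv.swap x y * Equiv.swap z w) ^ 3 = 1 := by
      decide
    rintro _ ⟨x, y, -, rfl⟩ _ ⟨z, w, -, rfl⟩
    rcases key x y z w with h | h
    · exact (orderOf_le_of_pow_eq_one (by norm_num) h).trans (by norm_num)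
    · exact orderOf_le_of_pow_eq_one (by norm_num) h

/-- The complete quadrilateral: the Fischer space of `Sym(4)`. -/
def quadrilateral : PartialTripleSystem transpositions :=
  fischerSpace isThreeTranspositionGroup_transpositions

theorem fischerSpace_collinear {G : Type*} [Group G] {D : Set G}
    (hD : IsThreeTranspositionGroup G D) {x y : D} (h : (fischerSpace hD).Collinear x y) :
    orderOf ((x : G) * y) = 3 := by
  obtain ⟨hne, l, ⟨d, e, f, h, hl⟩, hx, hy⟩ := h
  have hd := hD.involution d d.2
  have he := hD.involution e e.2
  have hf := hD.involution f f.2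
  obtain ⟨h1, h2, -⟩ := h.rotate hd he
  obtain ⟨h3, h4, -⟩ := h1.rotate he hf
  obtain ⟨-, h5, -⟩ := h3.rotate hf hd
  rw [hl] at hx hy
  rcases hx with rfl | rfl | rfl <;> rcases hy with rfl | rfl | rfl <;>
    first
    | exact absurd rfl hne
    | exact h.1
    | exact h1.1
    | exact h2.1
    | exact h3.1
    | exact h4.1
    | exact h5.1

theorem fischerSpace_mul {G : Type*} [Group G] {D : Set G} (hD : IsThreeTranspositionGroup G D)
    (R : Type*) [CommRing R] {x y z : D} (h : IsSymTriple (x : G) y z) :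
    Matsuo.basis (fischerSpace hD) R 1 x * Matsuo.basis (fischerSpace hD) R 1 y =
      Matsuo.basis (fischerSpace hD) R 1 x + Matsuo.basis (fischerSpace hD) R 1 y +
        Matsuo.basis (fischerSpace hD) R 1 z := by
  classical
  obtain ⟨-, -, h1, h2, h3⟩ := h.rotate (hD.involution x x.2) (hD.involution y y.2)
  have hl : ({x, y, z} : Finset D) ∈ (fischerSpace hD).lines := ⟨x, y, z, h, fun p => by simp⟩
  have hc : (fischerSpace hD).Collinear x y :=
    ⟨fun h => h1 (congrArg _ h), {x, y, z}, hl, by simp, by simp⟩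
  rw [Matsuo.basis_mul_basis, Matsuo.pointMul, if_pos hc, one_smul,
    (fischerSpace hD).third_eq (z := z) hc.1 (fun h => h2 (congrArg _ h))
      (fun h => h3 (congrArg _ h)) hl (by simp) (by simp) (by simp)]

theorem fischerSpace_mul_eq_zero {G : Type*} [Group G] {D : Set G}
    (hD : IsThreeTranspositionGroup G D)
    (R : Type*) [CommRing R] {x y : D} (h : ((x : G) * y) ^ 2 = 1) :
    Matsuo.basis (fischerSpace hD) R 1 x * Matsuo.basis (fischerSpace hD) R 1 y = 0 := by
  rw [Matsuo.basis_mul_basis, Matsuo.pointMul, if_neg]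
  intro hc
  have := orderOf_dvd_of_pow_eq_one h
  rw [fischerSpace_collinear hD hc] at this
  norm_num at this

/-- The transposition `(i j)`. -/
def tr (i j : Fin 4) (h : i ≠ j) : transpositions := ⟨Equiv.swap i j, i, j, h, rfl⟩

theorem tr_isSymTriple {i j l : Fin 4} (hij : i ≠ j) (hil : i ≠ l) (hjl : j ≠ l) :
    IsSymTriple (tr i j hij : Equiv.Perm (Fin 4)) (tr i l hil) (tr j l hjl) := by
  have key : ∀ i j l : Fin 4, i ≠ j → i ≠ l → j ≠ l →
      (Equiv.swap i j * Equiv.swap i l) ^ 3 = 1 ∧ Equiv.swap i j * Equiv.swap i l ≠ 1 ∧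
        Equiv.swap j l = Equiv.swap i j * Equiv.swap i l * Equiv.swap i j := by
    decide
  obtain ⟨h1, h2, h3⟩ := key i j l hij hil hjl
  exact ⟨orderOf_eq_prime h1 h2, h3⟩

theorem tr_mul_tr {i j l m : Fin 4} (hij : i ≠ j) (hlm : l ≠ m) (hil : i ≠ l) (him : i ≠ m)
    (hjl : j ≠ l) (hjm : j ≠ m) :
    ((tr i j hij : Equiv.Perm (Fin 4)) * (tr l m hlm : Equiv.Perm (Fin 4))) ^ 2 = 1 := by
  have key : ∀ i j l m : Fin 4, i ≠ l ∧ i ≠ m ∧ j ≠ l ∧ j ≠ m →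
      (Equiv.swap i j * Equiv.swap l m) ^ 2 = 1 := by
    decide
  exact key i j l m ⟨hil, him, hjl, hjm⟩

theorem exists_labels (l : Finset transpositions) (hl : l ∈ quadrilateral.lines) :
    ∃ (p q r : Fin 4) (hpq : p ≠ q) (hpr : p ≠ r) (hqr : q ≠ r),
      ∀ t, t ∈ l ↔ t = tr p q hpq ∨ t = tr p r hpr ∨ t = tr q r hqr := by
  obtain ⟨⟨_, x, y, hxy, rfl⟩, ⟨_, z, w, hzw, rfl⟩, ⟨f, hf⟩, ⟨h3, hfe⟩, hl⟩ := hl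
  have key : ∀ x y z w : Fin 4, x ≠ y → z ≠ w → (Equiv.swap x y * Equiv.swap z w) ^ 2 ≠ 1 →
      ∃ p q r : Fin 4, p ≠ q ∧ p ≠ r ∧ q ≠ r ∧ Equiv.swap x y = Equiv.swap p q ∧
        Equiv.swap z w = Equiv.swap p r := by
    decide
  have hne : (Equiv.swap x y * Equiv.swap z w) ^ 2 ≠ 1 := by
    intro h
    have := orderOf_dvd_of_pow_eq_one h
    rw [h3] at this
    norm_num at this
  obtain ⟨p, q, r, hpq, hpr, hqr, h1, h2⟩ := key x y z w hxy hzw hne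
  refine ⟨p, q, r, hpq, hpr, hqr, fun t => ?_⟩
  have h4 := (tr_isSymTriple hpq hpr hqr).2
  change Equiv.swap q r = Equiv.swap p q * Equiv.swap p r * Equiv.swap p q at h4
  rw [hl, Subtype.ext_iff, Subtype.ext_iff, Subtype.ext_iff, Subtype.ext_iff, Subtype.ext_iff,
    Subtype.ext_iff]
  change f = Equiv.swap x y * Equiv.swap z w * Equiv.swap x y at hfe
  rw [h1, h2, ← h4] at hfe
  simp only [hfe, h1, h2, tr]

/-- The nilpotent Matsuo algebra `A = M_k(G, 1)` of the complete quadrilateral `G`. -/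
abbrev QuadAlg (k : Type u) [Field k] : Type u := Matsuo quadrilateral k 1

/-- The reduced nilpotent Matsuo algebra `A' = A / Ann(A)`. -/
abbrev QuadAlg' (k : Type u) [Field k] : Type u := Reduced k (QuadAlg k)

section

variable {k A : Type*} [CommRing k] [NonUnitalNonAssocCommRing A] [Module k A]
  [IsScalarTower k A A] [SMulCommClass k A A]

theorem eigenFusion_of_table (h2 : ∀ u : A, u + u = 0) (a b c x y z : A)
    (hspan : Submodule.span k {a, b, c, x, y, z} = ⊤)
    (aa : a * a = 0) (bb : b * b = 0) (cc : c * c = 0)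
    (xx : x * x = 0) (yy : y * y = 0) (zz : z * z = 0)
    (ax : a * x = 0) (bY : b * y = 0) (cz : c * z = 0)
    (ab : a * b = a + b + c) (ac : a * c = a + b + c) (bc : b * c = a + b + c)
    (ay : a * y = a + y + z) (az : a * z = a + y + z) (yz : y * z = a + y + z)
    (bx : b * x = b + x + z) (bz : b * z = b + x + z) (xz : x * z = b + x + z)
    (cx : c * x = c + x + y) (cy : c * y = c + x + y) (xy : x * y = c + x + y) :
    EigenFusion (a + b + c) := by
  have h2' : ∀ u v : A, u + (u + v) = v := fun u v => by rw [← add_assoc, h2, zero_add]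
  have ind : ∀ P : A → Prop, (∀ u v, P u → P v → P (u + v)) → (∀ (r : k) u, P u → P (r • u)) →
      P a → P b → P c → P x → P y → P z → ∀ u, P u := by
    intro P hadd hsmul ha hb hc hx hy hz u
    have hu : u ∈ Submodule.span k {a, b, c, x, y, z} := hspan ▸ Submodule.mem_top
    induction hu using Submodule.span_induction with
    | mem u hu =>
      simp only [Set.mem_insert_iff, Set.mem_singleton_iff] at hu
      rcases hu with rfl | rfl | rfl | rfl | rfl | rfl <;> assumption
    | zero => simpa using hsmul 0 a ha
    | add u v _ _ hu hv => exact hadd u v hu hv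
    | smul r u _ hu => exact hsmul r u hu
  have ba := mul_comm b a ▸ ab
  have ca := mul_comm c a ▸ ac
  have cb := mul_comm c b ▸ bc
  have ya := mul_comm y a ▸ ay
  have za := mul_comm z a ▸ az
  have zy := mul_comm z y ▸ yz
  have xb := mul_comm x b ▸ bx
  have zb := mul_comm z b ▸ bz
  have zx := mul_comm z x ▸ xz
  have xc := mul_comm x c ▸ cx
  have yc := mul_comm y c ▸ cy
  have yx := mul_comm y x ▸ xy
  have xa := mul_comm x a ▸ ax
  have yb := mul_comm y b ▸ bY
  have zc := mul_comm z c ▸ cz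
  have ind2 : ∀ F : A → A → A, (∀ u v w, F (u + v) w = F u w + F v w) →
      (∀ u v w, F u (v + w) = F u v + F u w) → (∀ (r : k) u v, F (r • u) v = r • F u v) →
      (∀ (r : k) u v, F u (r • v) = r • F u v) →
      (F a a = 0 ∧ F a b = 0 ∧ F a c = 0 ∧ F a x = 0 ∧ F a y = 0 ∧ F a z = 0) →
      (F b a = 0 ∧ F b b = 0 ∧ F b c = 0 ∧ F b x = 0 ∧ F b y = 0 ∧ F b z = 0) →
      (F c a = 0 ∧ F c b = 0 ∧ F c c = 0 ∧ F c x = 0 ∧ F c y = 0 ∧ F c z = 0) →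
      (F x a = 0 ∧ F x b = 0 ∧ F x c = 0 ∧ F x x = 0 ∧ F x y = 0 ∧ F x z = 0) →
      (F y a = 0 ∧ F y b = 0 ∧ F y c = 0 ∧ F y x = 0 ∧ F y y = 0 ∧ F y z = 0) →
      (F z a = 0 ∧ F z b = 0 ∧ F z c = 0 ∧ F z x = 0 ∧ F z y = 0 ∧ F z z = 0) →
      ∀ u v, F u v = 0 := by
    intro F h1 h2 h3 h4 ha hb hc hx hy hz u
    have h5 : ∀ u, F u a = 0 ∧ F u b = 0 ∧ F u c = 0 ∧ F u x = 0 ∧ F u y = 0 ∧ F u z = 0 := by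
      refine ind _ ?_ ?_ ha hb hc hx hy hz
      · rintro u v ⟨p1, p2, p3, p4, p5, p6⟩ ⟨q1, q2, q3, q4, q5, q6⟩
        simp only [h1, p1, p2, p3, p4, p5, p6, q1, q2, q3, q4, q5, q6, add_zero, and_self]
      · rintro r u ⟨p1, p2, p3, p4, p5, p6⟩
        simp only [h3, p1, p2, p3, p4, p5, p6, smul_zero, and_self]
    obtain ⟨p1, p2, p3, p4, p5, p6⟩ := h5 u
    refine ind _ ?_ ?_ p1 p2 p3 p4 p5 p6
    · intro v w hv hw
      rw [h2, hv, hw, add_zero]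
    · intro r v hv
      rw [h4, hv, smul_zero]
  -- the operator `ad_s` on the basis
  have neg : ∀ u v : A, u + v = 0 → u = v := fun u v h => by
    have := h2' u v
    rw [h, add_zero] at this
    exact this
  obtain ⟨s, hs⟩ : ∃ s, s = a + b + c := ⟨_, rfl⟩
  rw [← hs]
  have sa : s * a = 0 := by
    simp only [hs, add_mul, aa, ba, ca, zero_add, h2]
  have sb : s * b = 0 := by
    simp only [hs, add_mul, bb, ab, cb, add_zero, h2]
  have sc : s * c = 0 := by
    simp only [hs, add_mul, cc, ac, bc, add_zero, h2]
  have sx : s * x = b + (c + (y + z)) := by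
    simp only [hs, add_mul, ax, bx, cx, zero_add, add_zero, add_comm, add_left_comm, h2', h2]
  have sy : s * y = a + (c + (x + z)) := by
    simp only [hs, add_mul, ay, bY, cy, zero_add, add_zero, add_comm, add_left_comm, h2', h2]
  have sz : s * z = a + (b + (x + y)) := by
    simp only [hs, add_mul, az, bz, cz, zero_add, add_zero, add_comm, add_left_comm, h2', h2]
  constructor
  · refine ind _ ?_ ?_ ?_ ?_ ?_ ?_ ?_ ?_
    · intro u v hu hv
      rw [mul_add, mul_add, hu, hv]
    · intro r u hu
      rw [mul_smul_comm, mul_smul_comm, hu]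
    all_goals
      simp only [mul_add, sa, sb, sc, sx, sy, sz, mul_zero, zero_add, add_zero, add_comm,
        add_left_comm, h2', h2]
  · refine ind2 (fun u v => s * u * (s * v)) ?_ ?_ ?_ ?_ ?_ ?_ ?_ ?_ ?_ ?_
    iterate 4 intros; simp only [mul_add, add_mul, smul_mul_assoc, mul_smul_comm]
    all_goals
      refine ⟨?_, ?_, ?_, ?_, ?_, ?_⟩
    all_goals
      simp only [mul_add, add_mul, sa, sb, sc, sx, sy, sz, mul_zero, zero_mul, zero_add, add_zero,
        aa, bb, cc, xx, yy, zz, ax, bY, cz, ab, ac, bc, ay, az, yz, bx, bz, xz, cx, cy, xy,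
        xa, yb, zc, ba, ca, cb, ya, za, zy, xb, zb, zx, xc, yc, yx,
        add_comm, add_left_comm, h2', h2]
  · intro u v
    refine neg _ _ (ind2 (fun u v => s * (u * (s * v)) + u * (s * v)) ?_ ?_ ?_ ?_ ?_ ?_ ?_ ?_ ?_ ?_
      u v)
    iterate 4
      intros
      simp only [mul_add, add_mul, smul_mul_assoc, mul_smul_comm, smul_add, add_assoc, add_comm,
        add_left_comm]
    all_goals
      refine ⟨?_, ?_, ?_, ?_, ?_, ?_⟩
    all_goals
      simp only [mul_add, add_mul, sa, sb, sc, sx, sy, sz, mul_zero, zero_mul, zero_add, add_zero,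
        aa, bb, cc, xx, yy, zz, ax, bY, cz, ab, ac, bc, ay, az, yz, bx, bz, xz, cx, cy, xy,
        xa, yb, zc, ba, ca, cb, ya, za, zy, xb, zb, zx, xc, yc, yx,
        add_comm, add_left_comm, h2', h2]
  · intro u v
    refine neg _ _ (ind2 (fun u v => s * (u * v) + (s * u * v + u * (s * v)))
      ?_ ?_ ?_ ?_ ?_ ?_ ?_ ?_ ?_ ?_ u v)
    iterate 4
      intros
      simp only [mul_add, add_mul, smul_mul_assoc, mul_smul_comm, smul_add, add_assoc, add_comm,
        add_left_comm]
    all_goals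
      refine ⟨?_, ?_, ?_, ?_, ?_, ?_⟩
    all_goals
      simp only [mul_add, add_mul, sa, sb, sc, sx, sy, sz, mul_zero, zero_mul, zero_add, add_zero,
        aa, bb, cc, xx, yy, zz, ax, bY, cz, ab, ac, bc, ay, az, yz, bx, bz, xz, cx, cy, xy,
        xa, yb, zc, ba, ca, cb, ya, za, zy, xb, zb, zx, xc, yc, yx,
        add_comm, add_left_comm, h2', h2]

end

/-- The eigenspaces of `ad_s`, for `s` the line nilpotent of a line, obey the fusion law. -/
theorem eigenFusion_lineSum (k : Type u) [Field k] [CharP k 2] (l : Finset transpositions)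
    (hl : l ∈ quadrilateral.lines) : EigenFusion (Matsuo.lineSum quadrilateral k 1 l) := by
  classical
  obtain ⟨p, q, r, hpq, hpr, hqr, hl⟩ := exists_labels l hl
  have hs : ∀ p q r : Fin 4, p ≠ q → p ≠ r → q ≠ r → ∃ s, p ≠ s ∧ q ≠ s ∧ r ≠ s ∧
      ∀ t, t = p ∨ t = q ∨ t = r ∨ t = s := by decide
  obtain ⟨s, hps, hqs, hrs, hall⟩ := hs p q r hpq hpr hqr
  have hl' : l = {tr p q hpq, tr p r hpr, tr q r hqr} := by ext t; simp [hl]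
  have hsw : ∀ i j (h : i ≠ j), tr i j h = tr j i h.symm := fun i j h =>
    Subtype.ext (Equiv.swap_comm i j)
  have hne : ∀ {i j : Fin 4} {h : i ≠ j} {i' j' : Fin 4} {h' : i' ≠ j'},
      Equiv.swap i j ≠ Equiv.swap i' j' → tr i j h ≠ tr i' j' h' :=
    fun h h' => h (congrArg Subtype.val h')
  have hsum : Matsuo.lineSum quadrilateral k 1 l =
      Matsuo.basis quadrilateral k 1 (tr p q hpq) + Matsuo.basis quadrilateral k 1 (tr p r hpr) +
        Matsuo.basis quadrilateral k 1 (tr q r hqr) := by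
    obtain ⟨-, -, h1, h2, h3⟩ := (tr_isSymTriple hpq hpr hqr).rotate
      (isThreeTranspositionGroup_transpositions.involution _ (Subtype.prop _))
      (isThreeTranspositionGroup_transpositions.involution _ (Subtype.prop _))
    rw [Matsuo.lineSum, hl', Finset.sum_insert, Finset.sum_insert, Finset.sum_singleton, add_assoc]
    · simpa using fun h => h3 (congrArg Subtype.val h).symm
    · simpa using ⟨fun h => h1 (congrArg Subtype.val h), fun h => h2 (congrArg Subtype.val h).symm⟩
  rw [hsum]
  set b := Matsuo.basis quadrilateral k 1 with hb
  have h2 : ∀ u : QuadAlg k, u + u = 0 := fun u => by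
    rw [← two_smul k u, CharTwo.two_eq_zero, zero_smul]
  have sq : ∀ t, b t * b t = 0 := fun t => by
    rw [hb, Matsuo.basis_mul_basis, Matsuo.pointMul, if_neg fun h => h.1 rfl]
  have line : ∀ {i j l : Fin 4} (hij : i ≠ j) (hil : i ≠ l) (hjl : j ≠ l),
      b (tr i j hij) * b (tr i l hil) = b (tr i j hij) + b (tr i l hil) + b (tr j l hjl) :=
    fun hij hil hjl => fischerSpace_mul _ k (tr_isSymTriple hij hil hjl)
  have opp : ∀ {i j l m : Fin 4} (hij : i ≠ j) (hlm : l ≠ m) (_ : i ≠ l) (_ : i ≠ m)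
      (_ : j ≠ l) (_ : j ≠ m), b (tr i j hij) * b (tr l m hlm) = 0 :=
    fun hij hlm h1 h2 h3 h4 => fischerSpace_mul_eq_zero _ k (tr_mul_tr hij hlm h1 h2 h3 h4)
  have line3 : ∀ {i j l : Fin 4} (hij : i ≠ j) (hil : i ≠ l) (hjl : j ≠ l),
      b (tr i j hij) * b (tr i l hil) = b (tr i j hij) + b (tr i l hil) + b (tr j l hjl) ∧
      b (tr i j hij) * b (tr j l hjl) = b (tr i j hij) + b (tr i l hil) + b (tr j l hjl) ∧
      b (tr i l hil) * b (tr j l hjl) = b (tr i j hij) + b (tr i l hil) + b (tr j l hjl) := by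
    intro i j l hij hil hjl
    refine ⟨line hij hil hjl, ?_, ?_⟩
    · rw [hsw i j, line hij.symm hjl hil]; abel
    · rw [hsw i l, hsw j l, line hil.symm hjl.symm hij]; abel
  obtain ⟨ab, ac, bc⟩ := line3 hpq hpr hqr
  obtain ⟨ay, az, yz⟩ := line3 hpq hps hqs
  obtain ⟨bx, bz, xz⟩ := line3 hpr hps hrs
  obtain ⟨cx, cy, xy⟩ := line3 hqr hqs hrs
  refine eigenFusion_of_table (k := k) h2 (b (tr p q hpq)) (b (tr p r hpr)) (b (tr q r hqr))
    (b (tr r s hrs)) (b (tr q s hqs)) (b (tr p s hps)) ?_ (sq _) (sq _) (sq _) (sq _) (sq _) (sq _)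
    (opp hpq hrs hpr hps hqr hqs) (opp hpr hqs hpq hps hqr.symm hrs)
    (opp hqr hps hpq.symm hqs hpr.symm hrs) ab ac bc ?_ ?_ ?_ ?_ ?_ ?_ ?_ ?_ ?_
  · rw [eq_top_iff, ← b.span_eq, Submodule.span_le]
    rintro _ ⟨⟨_, i, j, hij, rfl⟩, rfl⟩
    apply Submodule.subset_span
    change b (tr i j hij) ∈ _
    simp only [Set.mem_insert_iff, Set.mem_singleton_iff]
    rcases hall i with rfl | rfl | rfl | rfl <;> rcases hall j with rfl | rfl | rfl | rfl <;>
      first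
      | exact absurd rfl hij
      | simp
      | (rw [hsw]; simp)
  all_goals first
    | (rw [ay]; abel)
    | (rw [az]; abel)
    | (rw [mul_comm, yz]; abel)
    | (rw [bx]; abel)
    | (rw [bz]; abel)
    | (rw [mul_comm, xz]; abel)
    | (rw [cx]; abel)
    | (rw [cy]; abel)
    | (rw [mul_comm, xy]; abel)

/-- The algebra `A = M_k(G, 1)` of the complete quadrilateral, viewed as a `ℤ`-decomposition algebra:
for each line `l`, with line nilpotent `s_l`, the algebra decomposes into the eigenspaces of
`ad_{s_l}` for the eigenvalues `0` (degree `0`) and `1` (degree `1`). -/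
def quadDecomposition (k : Type u) [Field k] [CharP k 2] :
    ZDecomposition k (QuadAlg k) quadrilateral.lines :=
  adDecomposition k (fun l => Matsuo.lineSum quadrilateral k 1 l.1)
    fun l => eigenFusion_lineSum k l.1 l.2

/-- The reduced algebra `A' = A / Ann(A)`, viewed as a `ℤ`-decomposition algebra: for each line `l`,
the algebra decomposes into the eigenspaces of `ad_{s_l}`, where `s_l` is the image in `A'` of the
line nilpotent of `l`. -/
def quadDecomposition' (k : Type u) [Field k] [CharP k 2] :
    ZDecomposition k (QuadAlg' k) quadrilateral.lines :=
  adDecomposition k (fun l => Reduced.mk k (QuadAlg k) (Matsuo.lineSum quadrilateral k 1 l.1))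
    fun l => (eigenFusion_lineSum k l.1 l.2).reduced

end Quadrilateral
end NilpotentMatsuo
end

noncomputable section

namespace NilpotentMatsuo

/-! ### Scaling frames -/

/-! Let `s` be the line nilpotent of one line, and let `v₁`, `v₂` be its sums with the line
nilpotents of two other lines. Every point lies on two of the four lines, so in characteristic 2 the
four line nilpotents sum to zero; they are therefore exactly `s`, `s + v₁`, `s + v₂` and `s + v₁ +
v₂`. Each of them acts as a derivation with values in the plane `V` spanned by `v₁` and `v₂`, on
which `s` acts as the identity and whose square is zero. Hence for `w = (l - 1) s + b v₁ + c v₂`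
with `l` a unit, `1 + ad w` is an algebra automorphism acting on `V` as the scalar `l`. Composing
two of these reproduces the product of 𝔾ₐ² ⋊ 𝔾ₘ on the parameters `(b, c)` and `l`
(`transvection_transvection`). The parameters can be recovered from products with `v₁`, `p` and `q`,
so the resulting homomorphism `autHom` is injective.

Its image is closed: the candidate parameters of an automorphism `g` depend linearly on `g`, so
lying in the image amounts to the vanishing of the coordinates of certain `defect` elements. No
separate condition on `l` is needed, because invertibility of `g` already forces it to be a unit
(`isUnit_of_surjective`).

The Miyamoto map of `s + b v₁ + c v₂` at `l` is `1 + (l - 1) ad (s + b v₁ + c v₂)`, so every torus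
lies in this closed subgroup. Conversely, multiplying it by the inverse of the Miyamoto map of `s`
at `l` gives the unipotent element with parameters `(l - 1)(b, c)`. This reaches only scalars `r`
with `1 + r` a unit; closedness extends it to all `r`, by comparing `R[X]` with `R⟦X⟧`
(`semi_mem_of_isUnit`). The line nilpotents `s`, `s + v₁`, `s + v₂` then generate everything.

All of this uses only the data of a `ScalingFrame`. The frame of `A` descends to `A / Ann(A)`, since
its functionals factor through multiplications, so both algebras are covered by
`nonempty_miyamotoGroup_iso`. -/

/-- A scaling frame in a non-associative `R`-algebra `B`: elements `s`, `v₁`, `v₂` acting on `B` as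
derivations with values in the plane `⟨v₁, v₂⟩`, such that this plane has zero multiplication and
`s` acts as the identity on it, together with elements `p`, `q` and functionals `f₁`, `f₂` from
which the coefficients of a combination of `s`, `v₁`, `v₂` can be read off. -/
structure ScalingFrame (R B : Type*) [CommRing R] [NonUnitalNonAssocRing B] [Module R B] where
  (s v₁ v₂ p q : B)
  (f₁ f₂ : B →ₗ[R] R)
  s_mul_mem : ∀ u, s * u ∈ Submodule.span R {v₁, v₂}
  v₁_mul_mem : ∀ u, v₁ * u ∈ Submodule.span R {v₁, v₂}
  v₂_mul_mem : ∀ u, v₂ * u ∈ Submodule.span R {v₁, v₂}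
  s_mul_mul : ∀ u v, s * (u * v) = s * u * v + u * (s * v)
  v₁_mul_mul : ∀ u v, v₁ * (u * v) = v₁ * u * v + u * (v₁ * v)
  v₂_mul_mul : ∀ u v, v₂ * (u * v) = v₂ * u * v + u * (v₂ * v)
  s_mul_v₁ : s * v₁ = v₁
  s_mul_v₂ : s * v₂ = v₂
  v₁_mul_v₁ : v₁ * v₁ = 0
  v₁_mul_v₂ : v₁ * v₂ = 0
  v₂_mul_v₁ : v₂ * v₁ = 0
  v₂_mul_v₂ : v₂ * v₂ = 0
  s_mul_p : s * p = 0
  v₁_mul_p : v₁ * p = 0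
  v₂_mul_p : v₂ * p = v₁
  s_mul_q : s * q = 0
  v₁_mul_q : v₁ * q = v₂
  v₂_mul_q : v₂ * q = 0
  f₁_v₁ : f₁ v₁ = 1
  f₁_v₂ : f₁ v₂ = 0
  f₂_v₁ : f₂ v₁ = 0
  f₂_v₂ : f₂ v₂ = 1

namespace ScalingFrame

/-! ### Multiplication by combinations of `s`, `v₁`, `v₂`, and the automorphisms it yields. -/

section Algebra

variable {R B : Type*} [CommRing R] [NonUnitalNonAssocRing B] [Module R B]

/-- The combination of `s`, `v₁`, `v₂` with the given coefficients. -/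
def elt (F : ScalingFrame R B) (a b c : R) : B := a • F.s + b • F.v₁ + c • F.v₂

variable [IsScalarTower R B B] [SMulCommClass R B B] (F : ScalingFrame R B)

theorem elt_mul (a b c : R) (u : B) :
    F.elt a b c * u = a • (F.s * u) + b • (F.v₁ * u) + c • (F.v₂ * u) := by
  simp only [elt, add_mul, smul_mul_assoc]

theorem exists_elt_mul (a b c : R) (u : B) :
    ∃ d e : R, F.elt a b c * u = d • F.v₁ + e • F.v₂ := by
  have h : F.elt a b c * u ∈ Submodule.span R {F.v₁, F.v₂} := by
    rw [elt_mul]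
    exact add_mem (add_mem (Submodule.smul_mem _ _ (F.s_mul_mem u))
      (Submodule.smul_mem _ _ (F.v₁_mul_mem u))) (Submodule.smul_mem _ _ (F.v₂_mul_mem u))
  obtain ⟨d, e, h⟩ := Submodule.mem_span_pair.1 h
  exact ⟨d, e, h.symm⟩

theorem elt_mul_mul (a b c : R) (u v : B) :
    F.elt a b c * (u * v) = F.elt a b c * u * v + u * (F.elt a b c * v) := by
  simp only [elt_mul, F.s_mul_mul, F.v₁_mul_mul, F.v₂_mul_mul, smul_add, add_mul, mul_add,
    smul_mul_assoc, mul_smul_comm]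
  abel

theorem elt_mul_plane (a b c d e : R) :
    F.elt a b c * (d • F.v₁ + e • F.v₂) = a • (d • F.v₁ + e • F.v₂) := by
  simp only [elt_mul, mul_add, mul_smul_comm, F.s_mul_v₁, F.s_mul_v₂, F.v₁_mul_v₁, F.v₁_mul_v₂,
    F.v₂_mul_v₁, F.v₂_mul_v₂, smul_zero, add_zero]
  module

theorem elt_mul_mul_elt_mul (a b c a' b' c' : R) (u v : B) :
    (F.elt a b c * u) * (F.elt a' b' c' * v) = 0 := by
  obtain ⟨d, e, h⟩ := F.exists_elt_mul a b c u
  obtain ⟨d', e', h'⟩ := F.exists_elt_mul a' b' c' v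
  simp only [h, h', mul_add, add_mul, mul_smul_comm, smul_mul_assoc, F.v₁_mul_v₁, F.v₁_mul_v₂,
    F.v₂_mul_v₁, F.v₂_mul_v₂, smul_zero, add_zero]

/-- The inner product already lies in the plane, where only the `s`-component acts, as a scalar.
This makes a composite of two such multiplications linear in the inner coefficients. -/
theorem elt_mul_elt_mul (a b c a' b' c' : R) (u : B) :
    F.elt a b c * (F.elt a' b' c' * u) = a • (F.elt a' b' c' * u) := by
  obtain ⟨d, e, h⟩ := F.exists_elt_mul a' b' c' u
  rw [h, elt_mul_plane]

/-- Together with the next two lemmas this recovers all three coefficients: `v₁` detects `s`, while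
`q` and `p`, which `s` kills, are moved only by `v₁` and only by `v₂` respectively. -/
theorem f₁_elt_mul_v₁ (a b c : R) : F.f₁ (F.elt a b c * F.v₁) = a := by
  simp [elt_mul, F.s_mul_v₁, F.v₁_mul_v₁, F.v₂_mul_v₁, F.f₁_v₁]

theorem f₂_elt_mul_q (a b c : R) : F.f₂ (F.elt a b c * F.q) = b := by
  simp [elt_mul, F.s_mul_q, F.v₁_mul_q, F.v₂_mul_q, F.f₂_v₂]

theorem f₁_elt_mul_p (a b c : R) : F.f₁ (F.elt a b c * F.p) = c := by
  simp [elt_mul, F.s_mul_p, F.v₁_mul_p, F.v₂_mul_p, F.f₁_v₁]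

/-- The map `u ↦ u + ((l - 1) s + b v₁ + c v₂) u`. -/
def transvection (l b c : R) : B →ₗ[R] B :=
  LinearMap.id + LinearMap.mulLeft R (F.elt (l - 1) b c)

theorem transvection_apply (l b c : R) (u : B) :
    F.transvection l b c u = u + F.elt (l - 1) b c * u := rfl

/-- Multiplication by the element is a derivation, and the quadratic error term is a product of two
elements of the plane, hence zero. -/
theorem transvection_mul (l b c : R) (u v : B) :
    F.transvection l b c (u * v) = F.transvection l b c u * F.transvection l b c v := by
  simp only [transvection_apply, elt_mul_mul, add_mul, mul_add, elt_mul_mul_elt_mul, add_zero]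
  abel

/-- With `w`, `w'` the two elements, the composite is `1 + ad w + ad w' + ad w ad w'`, and the last
term equals `(l - 1) ad w'`. The parameters therefore combine as in the semidirect product. -/
theorem transvection_transvection (l b c l' b' c' : R) (u : B) :
    F.transvection l b c (F.transvection l' b' c' u) =
      F.transvection (l * l') (b + l * b') (c + l * c') u := by
  simp only [transvection_apply, mul_add, elt_mul_elt_mul]
  simp only [elt_mul]
  module

theorem transvection_one (u : B) : F.transvection 1 0 0 u = u := by
  simp [transvection_apply, elt_mul]

/-- If a map `u ↦ u + (a s + b v₁ + c v₂) u` is surjective, then it acts on `⟨v₁, v₂⟩` as an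
invertible scalar. -/
theorem isUnit_of_surjective {g : B → B} (hg : Function.Surjective g) {a b c : R}
    (h : ∀ u, g u = u + F.elt a b c * u) : IsUnit (1 + a) := by
  -- A preimage of `v₁` differs from it by an element of the plane, so it lies in the plane itself,
  -- where the map is the scalar `1 + a`. The `v₁`-coordinate `1 - d` of the preimage is then the
  -- inverse.
  obtain ⟨u, hu⟩ := hg F.v₁
  obtain ⟨d, e, hde⟩ := F.exists_elt_mul a b c u
  rw [h, hde] at hu
  have hu' : u = (1 - d) • F.v₁ + (-e) • F.v₂ := by
    rw [eq_sub_of_add_eq hu]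
    module
  rw [hu', elt_mul_plane] at hde
  have h1 := congrArg F.f₁ hde
  simp only [map_add, map_smul, F.f₁_v₁, F.f₁_v₂, smul_eq_mul, mul_one, mul_zero, add_zero] at h1
  refine IsUnit.of_mul_eq_one (1 - d) ?_
  linear_combination h1

end Algebra

/-! ### Extension of scalars of functionals and of scaling frames. -/

section BaseChange

variable {k B : Type u} [Field k] [NonUnitalNonAssocCommRing B] [Module k B]
  [IsScalarTower k B B] [SMulCommClass k B B]

/-- The base change of a linear functional. -/
def functionalBaseChange (f : B →ₗ[k] k) (R : Type u) [CommRing R] [Algebra k R] :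
    R ⊗[k] B →ₗ[R] R :=
  LinearMap.liftBaseChange R (Algebra.linearMap k R ∘ₗ f)

theorem functionalBaseChange_tmul (f : B →ₗ[k] k) (R : Type u) [CommRing R] [Algebra k R]
    (r : R) (b : B) : functionalBaseChange f R (r ⊗ₜ b) = r * algebraMap k R (f b) := by
  simp [functionalBaseChange]

theorem functionalBaseChange_tensorMap (f : B →ₗ[k] k) {R S : Type u} [CommRing R] [Algebra k R]
    [CommRing S] [Algebra k S] (φ : R →ₐ[k] S) (u : R ⊗[k] B) :
    functionalBaseChange f S (tensorMap B φ u) = φ (functionalBaseChange f R u) := by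
  induction u with
  | zero => simp
  | tmul r b => simp [functionalBaseChange_tmul]
  | add u v hu hv => rw [map_add, map_add, map_add, map_add, hu, hv]

/-- A basis of `B` over the field `k` remains a basis of `R ⊗ B`, and its coordinates there are the
base changes of functionals on `B`. This turns vanishing in `R ⊗ B` into equations in `R`, as
closedness requires. -/
theorem eq_zero_of_functionalBaseChange {R : Type u} [CommRing R] [Algebra k R] {u : R ⊗[k] B}
    (h : ∀ f : B →ₗ[k] k, functionalBaseChange f R u = 0) : u = 0 := by
  let b := Module.Basis.ofVectorSpace k B
  refine (b.baseChange R).ext_elem fun i => ?_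
  have key : ∀ w : R ⊗[k] B,
      (b.baseChange R).repr w i = functionalBaseChange (b.coord i) R w := by
    intro w
    induction w with
    | zero => simp
    | tmul r a =>
      simp [functionalBaseChange_tmul, Algebra.smul_def, mul_comm]
    | add u v hu hv => rw [map_add, map_add, Finsupp.add_apply, hu, hv]
  rw [key, h, map_zero, Finsupp.zero_apply]

variable (F : ScalingFrame k B) (R : Type u) [CommRing R] [Algebra k R]

/-- The base change of a scaling frame. -/
def baseChange : ScalingFrame R (R ⊗[k] B) :=
  have mem : ∀ w : B, (∀ u, w * u ∈ Submodule.span k {F.v₁, F.v₂}) → ∀ u : R ⊗[k] B,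
      (1 ⊗ₜ w) * u ∈ Submodule.span R {(1 : R) ⊗ₜ[k] F.v₁, 1 ⊗ₜ F.v₂} := by
    intro w hw u
    induction u with
    | zero => simp
    | tmul r a =>
      obtain ⟨d, e, h⟩ := Submodule.mem_span_pair.1 (hw a)
      rw [Algebra.TensorProduct.tmul_mul_tmul, ← h, Submodule.mem_span_pair]
      refine ⟨r * algebraMap k R d, r * algebraMap k R e, ?_⟩
      simp only [one_mul, tmul_add, tmul_smul, smul_tmul', smul_eq_mul, mul_one,
        Algebra.smul_def, mul_comm]
    | add u v hu hv => rw [mul_add]; exact add_mem hu hv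
  have der : ∀ w : B, (∀ u v, w * (u * v) = w * u * v + u * (w * v)) → ∀ u v : R ⊗[k] B,
      (1 ⊗ₜ w) * (u * v) = (1 ⊗ₜ w) * u * v + u * ((1 ⊗ₜ w) * v) := by
    intro w hw u v
    induction u with
    | zero => simp
    | add u u' hu hu' => simp only [mul_add, add_mul, hu, hu']; abel
    | tmul r a =>
      induction v with
      | zero => simp
      | add u u' hu hu' => simp only [mul_add, add_mul, hu, hu']; abel
      | tmul t b => simp only [Algebra.TensorProduct.tmul_mul_tmul, one_mul, hw, tmul_add]
  { s := 1 ⊗ₜ F.s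
    v₁ := 1 ⊗ₜ F.v₁
    v₂ := 1 ⊗ₜ F.v₂
    p := 1 ⊗ₜ F.p
    q := 1 ⊗ₜ F.q
    f₁ := functionalBaseChange F.f₁ R
    f₂ := functionalBaseChange F.f₂ R
    s_mul_mem := mem _ F.s_mul_mem
    v₁_mul_mem := mem _ F.v₁_mul_mem
    v₂_mul_mem := mem _ F.v₂_mul_mem
    s_mul_mul := der _ F.s_mul_mul
    v₁_mul_mul := der _ F.v₁_mul_mul
    v₂_mul_mul := der _ F.v₂_mul_mul
    s_mul_v₁ := by simp [F.s_mul_v₁]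
    s_mul_v₂ := by simp [F.s_mul_v₂]
    v₁_mul_v₁ := by simp [F.v₁_mul_v₁]
    v₁_mul_v₂ := by simp [F.v₁_mul_v₂]
    v₂_mul_v₁ := by simp [F.v₂_mul_v₁]
    v₂_mul_v₂ := by simp [F.v₂_mul_v₂]
    s_mul_p := by simp [F.s_mul_p]
    v₁_mul_p := by simp [F.v₁_mul_p]
    v₂_mul_p := by simp [F.v₂_mul_p]
    s_mul_q := by simp [F.s_mul_q]
    v₁_mul_q := by simp [F.v₁_mul_q]
    v₂_mul_q := by simp [F.v₂_mul_q]
    f₁_v₁ := by simp [functionalBaseChange_tmul, F.f₁_v₁]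
    f₁_v₂ := by simp [functionalBaseChange_tmul, F.f₁_v₂]
    f₂_v₁ := by simp [functionalBaseChange_tmul, F.f₂_v₁]
    f₂_v₂ := by simp [functionalBaseChange_tmul, F.f₂_v₂] }

variable {R} {S : Type u} [CommRing S] [Algebra k S] (φ : R →ₐ[k] S)

theorem tensorMap_elt (a b c : R) :
    tensorMap B φ ((F.baseChange R).elt a b c) = (F.baseChange S).elt (φ a) (φ b) (φ c) := by
  simp [elt, tensorMap_smul, baseChange]

end BaseChange

end ScalingFrame

end NilpotentMatsuo

end
noncomputable section

namespace NilpotentMatsuo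

namespace ScalingFrame

variable {k B : Type u} [Field k] [NonUnitalNonAssocCommRing B] [Module k B]
  [IsScalarTower k B B] [SMulCommClass k B B] (F : ScalingFrame k B)

/-! ### The closed subgroup of transvections -/

section Points

variable (R : Type u) [CommRing R] [Algebra k R]

/-- The homomorphism `R² ⋊ Rˣ → Aut_R(R ⊗ B)` given by transvections. -/
def autHom : Multiplicative (R × R) ⋊[scaleAction R] Rˣ →* autPoints k B R where
  toFun x :=
    ⟨LinearEquiv.ofLinearMap
      ((F.baseChange R).transvection x.right x.left.toAdd.1 x.left.toAdd.2)
      ((F.baseChange R).transvection x⁻¹.right x⁻¹.left.toAdd.1 x⁻¹.left.toAdd.2)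
      (LinearMap.ext fun u => by
        -- The composite has the parameters of `x * x⁻¹`, which is the identity; the equality is
        -- compared component by component.
        have h := mul_inv_cancel x
        have h1 := congrArg (fun y => (y.right : R)) h
        have h2 := congrArg (fun y => y.left.toAdd.1) h
        have h3 := congrArg (fun y => y.left.toAdd.2) h
        rw [LinearMap.comp_apply, transvection_transvection, LinearMap.id_apply]
        exact (congr (congr (congrArg (fun a b c => (F.baseChange R).transvection a b c u) h1) h2)
          h3).trans (transvection_one _ u))
      (LinearMap.ext fun u => by
        have h := inv_mul_cancel x
        have h1 := congrArg (fun y => (y.right : R)) h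
        have h2 := congrArg (fun y => y.left.toAdd.1) h
        have h3 := congrArg (fun y => y.left.toAdd.2) h
        rw [LinearMap.comp_apply, transvection_transvection, LinearMap.id_apply]
        exact (congr (congr (congrArg (fun a b c => (F.baseChange R).transvection a b c u) h1) h2)
          h3).trans (transvection_one _ u)),
      fun u v => transvection_mul _ _ _ _ u v⟩
  map_one' := Subtype.ext <| LinearEquiv.ext fun u => transvection_one _ u
  map_mul' x y := Subtype.ext <| LinearEquiv.ext fun u =>
    (transvection_transvection _ _ _ _ _ _ _ u).symm

variable {R}

/-- The element `(b, c) l` of `R² ⋊ Rˣ`. -/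
def semi (l : Rˣ) (b c : R) : Multiplicative (R × R) ⋊[scaleAction R] Rˣ :=
  ⟨Multiplicative.ofAdd (b, c), l⟩

theorem semi_mul_semi (l l' : Rˣ) (b c b' c' : R) :
    semi l b c * semi l' b' c' = semi (l * l') (b + l * b') (c + l * c') := rfl

theorem autHom_semi (l : Rˣ) (b c : R) (u : R ⊗[k] B) :
    (F.autHom R (semi l b c)).1 u = u + (F.baseChange R).elt (l - 1) b c * u := rfl

theorem autHom_injective : Function.Injective (F.autHom R) := by
  rintro ⟨⟨b, c⟩, l⟩ ⟨⟨b', c'⟩, l'⟩ h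
  have h' : ∀ u, (F.baseChange R).elt (l - 1) b c * u = (F.baseChange R).elt (l' - 1) b' c' * u :=
    fun u => add_left_cancel (congrArg (fun g => g.1 u) h : u + _ = u + _)
  have h1 := congrArg (F.baseChange R).f₁ (h' (F.baseChange R).v₁)
  have h2 := congrArg (F.baseChange R).f₂ (h' (F.baseChange R).q)
  have h3 := congrArg (F.baseChange R).f₁ (h' (F.baseChange R).p)
  rw [f₁_elt_mul_v₁, f₁_elt_mul_v₁, sub_left_inj] at h1
  rw [f₂_elt_mul_q, f₂_elt_mul_q] at h2
  rw [f₁_elt_mul_p, f₁_elt_mul_p] at h3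
  obtain rfl := Units.ext h1
  subst h2 h3
  rfl

/-- The first parameter is unrestricted on the right: as `g` is bijective, `1 + a` is automatically
a unit. Membership thus becomes a purely linear condition. -/
theorem mem_range_autHom {g : autPoints k B R} :
    g ∈ (F.autHom R).range ↔
      ∃ a b c : R, ∀ u, g.1 u = u + (F.baseChange R).elt a b c * u := by
  constructor
  · rintro ⟨⟨⟨b, c⟩, l⟩, rfl⟩
    exact ⟨l - 1, b, c, fun u => rfl⟩
  · rintro ⟨a, b, c, h⟩
    obtain ⟨l, hl⟩ := (F.baseChange R).isUnit_of_surjective g.1.surjective h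
    refine ⟨semi l b c, Subtype.ext <| LinearEquiv.ext fun u => ?_⟩
    rw [autHom_semi, hl, add_sub_cancel_left, h]

variable {S : Type u} [CommRing S] [Algebra k S] (φ : R →ₐ[k] S)

/-- The elements `g (1 ⊗ a) - 1 ⊗ a - w (1 ⊗ a)`, where `w` is the only candidate for a combination
of `s`, `v₁`, `v₂` with `g u = u + w u` for all `u`. -/
def defect (g : R ⊗[k] B →ₗ[R] R ⊗[k] B) (a : B) : R ⊗[k] B :=
  g (1 ⊗ₜ a) - 1 ⊗ₜ a -
    (F.baseChange R).elt ((F.baseChange R).f₁ (g (1 ⊗ₜ F.v₁) - 1 ⊗ₜ F.v₁))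
      ((F.baseChange R).f₂ (g (1 ⊗ₜ F.q) - 1 ⊗ₜ F.q))
      ((F.baseChange R).f₁ (g (1 ⊗ₜ F.p) - 1 ⊗ₜ F.p)) * (1 ⊗ₜ a)

/-- The candidate coefficients are read off by functionals defined over `k`, so every ingredient of
the defect commutes with `φ`. -/
theorem defect_baseChangeEnd (g : R ⊗[k] B →ₗ[R] R ⊗[k] B) (a : B) :
    F.defect (baseChangeEnd φ g) a = tensorMap B φ (F.defect g a) := by
  have h : ∀ a : B, baseChangeEnd φ g (1 ⊗ₜ a) - 1 ⊗ₜ a = tensorMap B φ (g (1 ⊗ₜ a) - 1 ⊗ₜ a) :=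
    fun a => by rw [baseChangeEnd_tmul, one_smul, map_sub, tensorMap_tmul, map_one]
  have h1 : ∀ u, (F.baseChange S).f₁ (tensorMap B φ u) = φ ((F.baseChange R).f₁ u) :=
    functionalBaseChange_tensorMap _ φ
  have h2 : ∀ u, (F.baseChange S).f₂ (tensorMap B φ u) = φ ((F.baseChange R).f₂ u) :=
    functionalBaseChange_tensorMap _ φ
  rw [defect, defect, map_sub (tensorMap B φ), tensorMap_mul, tensorMap_elt, ← h a, ← h1, ← h1,
    ← h2, h, h, h, h, tensorMap_tmul, map_one]

theorem mem_range_autHom_iff_defect {g : autPoints k B R} :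
    g ∈ (F.autHom R).range ↔ ∀ a, F.defect g.1.toLinearMap a = 0 := by
  rw [mem_range_autHom]
  constructor
  · rintro ⟨a, b, c, h⟩ t
    have h' : ∀ u, g.1 u - u = (F.baseChange R).elt a b c * u := fun u => by
      rw [h, add_sub_cancel_left]
    -- For a genuine transvection the three functionals return its true coefficients, so the
    -- candidate combination is the right one and the difference cancels.
    simp only [defect, LinearEquiv.coe_coe, h']
    have h1 := (F.baseChange R).f₁_elt_mul_v₁ a b c
    have h2 := (F.baseChange R).f₂_elt_mul_q a b c
    have h3 := (F.baseChange R).f₁_elt_mul_p a b c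
    simp only [baseChange] at h1 h2 h3 ⊢
    rw [h1, h2, h3, sub_self]
  · intro h
    refine ⟨_, _, _, LinearMap.congr_fun (end_ext (g := g.1.toLinearMap)
      (h := LinearMap.id + LinearMap.mulLeft R _) fun a =>
        eq_add_of_sub_eq' (sub_eq_zero.1 (h a)))⟩

theorem autMap_autHom (x : Multiplicative (R × R) ⋊[scaleAction R] Rˣ) :
    autMap φ (F.autHom R x) = F.autHom S (((gaSqGm k).map (CommAlgCat.ofHom φ)).hom x) := by
  refine Subtype.ext <| LinearEquiv.toLinearMap_injective <| end_ext fun a => ?_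
  obtain ⟨⟨b, c⟩, l⟩ := x
  change baseChangeEnd φ _ (1 ⊗ₜ a) = 1 ⊗ₜ a + (F.baseChange S).elt (φ l - 1) (φ b) (φ c) * (1 ⊗ₜ a)
  rw [baseChangeEnd_tmul, one_smul]
  change tensorMap B φ (1 ⊗ₜ a + (F.baseChange R).elt (l - 1) b c * (1 ⊗ₜ a)) = _
  rw [map_add, tensorMap_mul, tensorMap_elt, tensorMap_tmul, map_sub, map_one]

end Points

/-- The closed subgroup of `Aut(B)` formed by the transvections. -/
def transvectionSubgroup : ClosedSubgroup (autFunctor k B) where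
  points R := (F.autHom R).range
  map_mem := by
    rintro R S φ _ ⟨x, rfl⟩
    exact ⟨_, (F.autMap_autHom φ.hom x).symm⟩
  closed R g := by
    -- The defining ideal is generated by the values of all base-changed functionals on all defects
    -- of `g`.
    refine ⟨Ideal.span {r | ∃ (a : B) (f : B →ₗ[k] k),
      r = functionalBaseChange f R (F.defect g.1.toLinearMap a)}, fun S φ => ?_⟩
    have h : ∀ a, F.defect (autMap φ.hom g).1.toLinearMap a =
        tensorMap B φ.hom (F.defect g.1.toLinearMap a) := F.defect_baseChangeEnd φ.hom _
    refine (F.mem_range_autHom_iff_defect (g := autMap φ.hom g)).trans ?_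
    simp only [h]
    constructor
    · intro h0
      change _ ≤ RingHom.ker φ.hom
      rw [Ideal.span_le]
      rintro _ ⟨a, f, rfl⟩
      change φ.hom _ = 0
      rw [← functionalBaseChange_tensorMap, h0, map_zero]
    · intro h0 a
      refine eq_zero_of_functionalBaseChange fun f => ?_
      rw [functionalBaseChange_tensorMap]
      exact h0 _ (Ideal.subset_span ⟨a, f, rfl⟩)

/-- The group functor of transvections is isomorphic to `𝔾ₐ² ⋊ 𝔾ₘ`. -/
def transvectionSubgroupIso : F.transvectionSubgroup.toFunctor ≅ gaSqGm k :=
  (NatIso.ofComponents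
    (F := gaSqGm k) (G := F.transvectionSubgroup.toFunctor)
    (fun R => (MonoidHom.ofInjective (F.autHom_injective (R := R))).toGrpIso)
    fun {R S} φ => GrpCat.hom_ext <| MonoidHom.ext fun x => by
      refine Subtype.val_injective ?_
      change F.autHom S (((gaSqGm k).map φ).hom x) = autMap φ.hom (F.autHom R x)
      exact (F.autMap_autHom φ.hom x).symm).symm

/-! ### Generation by tori -/

section Generation

/-- The parameters of the transvections in a closed subgroup. -/
def parameters (H : ClosedSubgroup (autFunctor k B)) (R : CommAlgCat.{u} k) :
    Subgroup (Multiplicative (R × R) ⋊[scaleAction R] Rˣ) :=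
  (H.points R).comap (F.autHom R : _ →* (autFunctor k B).obj R)

/-- Since `b` and `c` come from `k`, specialising the scalar along `φ` moves only `r`. -/
theorem map_mem_parameters_iff (H : ClosedSubgroup (autFunctor k B)) {R S : CommAlgCat.{u} k}
    (φ : R ⟶ S) (b c : k) (r : R) :
    ((autFunctor k B).map φ).hom
        (F.autHom R (semi 1 (r * algebraMap k R b) (r * algebraMap k R c))) ∈ H.points S ↔
      semi 1 (φ.hom r * algebraMap k S b) (φ.hom r * algebraMap k S c) ∈ F.parameters H S := by
  refine iff_of_eq (congrArg (· ∈ H.points S) ?_)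
  refine (F.autMap_autHom φ.hom _).trans (congrArg (F.autHom S) ?_)
  rw [← φ.hom.commutes b, ← φ.hom.commutes c, ← map_mul, ← map_mul]
  exact SemidirectProduct.ext rfl (map_one (Units.map (φ.hom : R →* S)))

/-- If a closed subgroup contains the transvections with parameters `(1, r b, r c)` whenever `1 + r`
is a unit, then it contains them for all `r`. -/
theorem semi_mem_of_isUnit (H : ClosedSubgroup (autFunctor k B)) (b c : k)
    (h : ∀ (R : CommAlgCat.{u} k) (r : R), IsUnit (1 + r) →
      semi 1 (r * algebraMap k R b) (r * algebraMap k R c) ∈ F.parameters H R)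
    (R : CommAlgCat.{u} k) (r : R) :
    semi 1 (r * algebraMap k R b) (r * algebraMap k R c) ∈ F.parameters H R := by
  let P : CommAlgCat.{u} k := CommAlgCat.of k (Polynomial R)
  let Q : CommAlgCat.{u} k := CommAlgCat.of k (PowerSeries R)
  let X : P := (Polynomial.X : Polynomial R)
  -- This is the universal case: the transvection whose scalar is the indeterminate. If its defining
  -- ideal `I` is zero, every specialisation of it lies in `H`.
  obtain ⟨I, hI⟩ := H.closed P (F.autHom P (semi 1 (X * algebraMap k P b) (X * algebraMap k P c)))
  have hI0 : ∀ t ∈ I, t = 0 := by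
    -- In `R⟦X⟧` the element `1 + X` is a unit, so the hypothesis applies there and `φ` kills `I`.
    -- As `R[X]` embeds in `R⟦X⟧`, `I` is zero.
    let φ : P ⟶ Q := CommAlgCat.ofHom ((Polynomial.coeToPowerSeries.algHom R).restrictScalars k)
    have hφ : ∀ x : Polynomial R, φ.hom x = (x : PowerSeries R) := fun x => by
      change Polynomial.coeToPowerSeries.algHom R x = _
      rw [Polynomial.coeToPowerSeries.algHom_apply]
      simp
    intro t ht
    have h0 : φ.hom t = 0 := by
      refine (hI Q φ).1 ((F.map_mem_parameters_iff H φ b c X).2 (h Q _ ?_)) t ht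
      rw [hφ]
      refine PowerSeries.isUnit_iff_constantCoeff.2 ?_
      simp [X]
    rw [hφ] at h0
    exact Polynomial.coe_eq_zero_iff.1 h0
  let ψ : P ⟶ R := CommAlgCat.ofHom ((Polynomial.aeval (R := R) (r : R)).restrictScalars k)
  have h1 := (F.map_mem_parameters_iff H ψ b c X).1
    ((hI R ψ).2 fun t ht => by rw [hI0 t ht, map_zero])
  rwa [show ψ.hom X = r from Polynomial.aeval_X (R := R) r] at h1

variable {ι : Type*} {D : ZDecomposition k B ι}

/-- A Miyamoto map of an eigenspace decomposition is a transvection. -/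
theorem autHom_isMiyamotoMap {s : ι → B} (h : ∀ i, EigenFusion (s i)) {i : ι} {b c : k}
    (hi : s i = F.elt 1 b c) {R : Type u} [CommRing R] [Algebra k R] (l : Rˣ) :
    IsMiyamotoMap (adDecomposition k s h) i l
      (F.autHom R (semi l ((l - 1) * algebraMap k R b) ((l - 1) * algebraMap k R c))) := by
  -- The parameters are those of `(l - 1) s i`. Adding this multiplication to the identity gives `1`
  -- where `s i` acts as `0` and `l` where it acts as `1`.
  have key : (F.baseChange R).elt (l - 1) ((l - 1) * algebraMap k R b)
      ((l - 1) * algebraMap k R c) = ((l : R) - 1) • (1 ⊗ₜ s i) := by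
    rw [hi]
    simp only [elt, baseChange, tmul_add, tmul_smul, one_smul, smul_add, mul_smul, algebraMap_smul]
  intro n a ha
  rw [autHom_semi, key, smul_mul_assoc, Algebra.TensorProduct.tmul_mul_tmul, one_mul]
  change a ∈ adPart k (s i) n at ha
  by_cases h0 : n = 0
  · subst h0
    rw [mem_adPart_zero] at ha
    simp [ha]
  by_cases h1 : n = 1
  · subst h1
    rw [mem_adPart_one] at ha
    rw [ha, zpow_one]
    module
  · rw [adPart_eq_bot h0 h1, Submodule.mem_bot] at ha
    simp [ha]

/-- The parts span `B`, and an `R`-linear map is determined by its values on the elements `1 ⊗ a`.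
-/
theorem isMiyamotoMap_unique {i : ι} {R : Type u} [CommRing R] [Algebra k R] {l : Rˣ}
    {g g' : autPoints k B R} (h : IsMiyamotoMap D i l g) (h' : IsMiyamotoMap D i l g') :
    g = g' := by
  refine Subtype.ext <| LinearEquiv.toLinearMap_injective <| end_ext fun a => ?_
  have ha : a ∈ ⨆ n, D.part i n := by
    rw [(D.isInternal i).submodule_iSup_eq_top]
    trivial
  induction ha using Submodule.iSup_induction' with
  | mem n a ha => exact (h n a ha).trans (h' n a ha).symm
  | zero => simp
  | add a b _ _ ha hb => rw [tmul_add, map_add, map_add, ha, hb]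

/-- If the elements `s i` are of the form `s + b v₁ + c v₂` and contain `s`, `s + v₁` and `s + v₂`,
then the Miyamoto group of the associated eigenspace decomposition is the group of
transvections. -/
theorem generated_torus_eq {s : ι → B} (h : ∀ i, EigenFusion (s i))
    (hs : ∀ i, ∃ b c : k, s i = F.elt 1 b c) {i₀ i₁ i₂ : ι} (h₀ : s i₀ = F.elt 1 0 0)
    (h₁ : s i₁ = F.elt 1 1 0) (h₂ : s i₂ = F.elt 1 0 1) (R : CommAlgCat.{u} k) :
    (ClosedSubgroup.generated (torus (adDecomposition k s h))).points R =
      F.transvectionSubgroup.points R := by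
  refine le_antisymm (ClosedSubgroup.generated_le _ _ (fun i R => ?_) R) ?_
  · rw [torus, Subgroup.closure_le]
    rintro g ⟨l, hg⟩
    obtain ⟨b, c, hi⟩ := hs i
    rw [isMiyamotoMap_unique hg (F.autHom_isMiyamotoMap h hi l)]
    exact ⟨_, rfl⟩
  · set H := ClosedSubgroup.generated (torus (adDecomposition k s h))
    have tor : ∀ (R : CommAlgCat.{u} k) (i : ι) (b c : k), s i = F.elt 1 b c → ∀ l : Rˣ,
        semi l ((l - 1) * algebraMap k R b) ((l - 1) * algebraMap k R c) ∈ F.parameters H R :=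
      fun R i b c hi l => ClosedSubgroup.le_generated _ i R
        (Subgroup.subset_closure ⟨l, F.autHom_isMiyamotoMap h hi l⟩)
    have tor₀ : ∀ (R : CommAlgCat.{u} k) (l : Rˣ), semi l 0 0 ∈ F.parameters H R :=
      fun R l => by simpa using tor R i₀ 0 0 h₀ l
    have uni : ∀ (i : ι) (b c : k), s i = F.elt 1 b c → ∀ (R : CommAlgCat.{u} k) (r : R),
        semi 1 (r * algebraMap k R b) (r * algebraMap k R c) ∈ F.parameters H R := by
      intro i b c hi
      refine F.semi_mem_of_isUnit H b c fun R r hr => ?_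
      obtain ⟨l, hl⟩ := hr
      -- With `l = 1 + r`, the scalar parts cancel and leave the unipotent element with parameters
      -- `(l - 1)(b, c) = r (b, c)`.
      have h1 := mul_mem (tor R i b c hi l) (tor₀ R l⁻¹)
      simpa only [semi_mul_semi, mul_inv_cancel, mul_zero, add_zero, hl, add_sub_cancel_left]
        using h1
    rintro _ ⟨⟨⟨b, c⟩, l⟩, rfl⟩
    -- The factorisation `(b, c) l = (b, 0) (0, c) l` uses the three distinguished indices `i₁`,
    -- `i₂`, `i₀` in this order.
    have h3 := mul_mem (mul_mem (uni i₁ 1 0 h₁ R b) (uni i₂ 0 1 h₂ R c)) (tor₀ R l)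
    simp only [semi_mul_semi, map_one, map_zero, mul_one, mul_zero, add_zero, zero_add, one_mul,
      Units.val_one] at h3
    exact h3

/-- Under the assumptions of `generated_torus_eq`, the Miyamoto group is `𝔾ₐ² ⋊ 𝔾ₘ`. -/
theorem nonempty_miyamotoGroup_iso {s : ι → B} (h : ∀ i, EigenFusion (s i))
    (hs : ∀ i, ∃ b c : k, s i = F.elt 1 b c) {i₀ i₁ i₂ : ι} (h₀ : s i₀ = F.elt 1 0 0)
    (h₁ : s i₁ = F.elt 1 1 0) (h₂ : s i₂ = F.elt 1 0 1) :
    Nonempty (miyamotoGroup (adDecomposition k s h) ≅ gaSqGm k) :=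
  ⟨NatIso.ofComponents
    (fun R => (MulEquiv.subgroupCongr (F.generated_torus_eq h hs h₀ h₁ h₂ R)).toGrpIso)
    (fun _ => rfl) ≪≫ F.transvectionSubgroupIso⟩

end Generation

end ScalingFrame

end NilpotentMatsuo

end
noncomputable section

namespace NilpotentMatsuo

/-! ### The scaling frames of the complete quadrilateral -/

/-! ### Passage of a scaling frame to the quotient by the annihilator. -/

section Reduced

variable {k A : Type*} [CommRing k] [NonUnitalNonAssocCommRing A] [Module k A]
  [IsScalarTower k A A] [SMulCommClass k A A]

/-- The image of a scaling frame in `A / Ann(A)`. -/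
def ScalingFrame.reduced (F : ScalingFrame k A) (h₁ : annihilator k A ≤ LinearMap.ker F.f₁)
    (h₂ : annihilator k A ≤ LinearMap.ker F.f₂) : ScalingFrame k (Reduced k A) :=
  have mem : ∀ w : A, (∀ u, w * u ∈ Submodule.span k {F.v₁, F.v₂}) → ∀ u : Reduced k A,
      Reduced.mk k A w * u ∈ Submodule.span k {Reduced.mk k A F.v₁, Reduced.mk k A F.v₂} := by
    intro w hw u
    obtain ⟨u, rfl⟩ := Reduced.mk_surjective k A u
    obtain ⟨d, e, h⟩ := Submodule.mem_span_pair.1 (hw u)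
    rw [← Reduced.mk_mul, ← h, map_add, map_smul, map_smul]
    exact Submodule.mem_span_pair.2 ⟨d, e, rfl⟩
  have der : ∀ w : A, (∀ u v, w * (u * v) = w * u * v + u * (w * v)) → ∀ u v : Reduced k A,
      Reduced.mk k A w * (u * v) = Reduced.mk k A w * u * v + u * (Reduced.mk k A w * v) := by
    intro w hw u v
    obtain ⟨u, rfl⟩ := Reduced.mk_surjective k A u
    obtain ⟨v, rfl⟩ := Reduced.mk_surjective k A v
    simp only [← Reduced.mk_mul, hw, map_add]
  { s := Reduced.mk k A F.s
    v₁ := Reduced.mk k A F.v₁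
    v₂ := Reduced.mk k A F.v₂
    p := Reduced.mk k A F.p
    q := Reduced.mk k A F.q
    f₁ := (annihilator k A).liftQ F.f₁ h₁
    f₂ := (annihilator k A).liftQ F.f₂ h₂
    s_mul_mem := mem _ F.s_mul_mem
    v₁_mul_mem := mem _ F.v₁_mul_mem
    v₂_mul_mem := mem _ F.v₂_mul_mem
    s_mul_mul := der _ F.s_mul_mul
    v₁_mul_mul := der _ F.v₁_mul_mul
    v₂_mul_mul := der _ F.v₂_mul_mul
    s_mul_v₁ := by rw [← Reduced.mk_mul, F.s_mul_v₁]
    s_mul_v₂ := by rw [← Reduced.mk_mul, F.s_mul_v₂]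
    v₁_mul_v₁ := by rw [← Reduced.mk_mul, F.v₁_mul_v₁, map_zero]
    v₁_mul_v₂ := by rw [← Reduced.mk_mul, F.v₁_mul_v₂, map_zero]
    v₂_mul_v₁ := by rw [← Reduced.mk_mul, F.v₂_mul_v₁, map_zero]
    v₂_mul_v₂ := by rw [← Reduced.mk_mul, F.v₂_mul_v₂, map_zero]
    s_mul_p := by rw [← Reduced.mk_mul, F.s_mul_p, map_zero]
    v₁_mul_p := by rw [← Reduced.mk_mul, F.v₁_mul_p, map_zero]
    v₂_mul_p := by rw [← Reduced.mk_mul, F.v₂_mul_p]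
    s_mul_q := by rw [← Reduced.mk_mul, F.s_mul_q, map_zero]
    v₁_mul_q := by rw [← Reduced.mk_mul, F.v₁_mul_q]
    v₂_mul_q := by rw [← Reduced.mk_mul, F.v₂_mul_q, map_zero]
    f₁_v₁ := F.f₁_v₁
    f₁_v₂ := F.f₁_v₂
    f₂_v₁ := F.f₂_v₁
    f₂_v₂ := F.f₂_v₂ }

theorem ScalingFrame.reduced_elt (F : ScalingFrame k A)
    (h₁ : annihilator k A ≤ LinearMap.ker F.f₁) (h₂ : annihilator k A ≤ LinearMap.ker F.f₂)
    (a b c : k) : (F.reduced h₁ h₂).elt a b c = Reduced.mk k A (F.elt a b c) := by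
  simp only [elt, reduced, map_add, map_smul]

end Reduced

/-! ### The frame extracted from the multiplication table. -/

section Table

variable {k A : Type*} [CommRing k] [NonUnitalNonAssocCommRing A] [Module k A]
  [IsScalarTower k A A] [SMulCommClass k A A]

/-- The scaling frame of an algebra with the multiplication table of the nilpotent Matsuo algebra of
the complete quadrilateral with lines `abc`, `ayz`, `bxz`, `cxy`, in characteristic `2`. -/
def ScalingFrame.ofTable (h2 : ∀ u : A, u + u = 0) (a b c x y z : A)
    (hspan : Submodule.span k {a, b, c, x, y, z} = ⊤)
    (aa : a * a = 0) (bb : b * b = 0) (cc : c * c = 0)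
    (xx : x * x = 0) (yy : y * y = 0) (zz : z * z = 0)
    (ax : a * x = 0) (bY : b * y = 0) (cz : c * z = 0)
    (ab : a * b = a + b + c) (ac : a * c = a + b + c) (bc : b * c = a + b + c)
    (ay : a * y = a + y + z) (az : a * z = a + y + z) (yz : y * z = a + y + z)
    (bx : b * x = b + x + z) (bz : b * z = b + x + z) (xz : x * z = b + x + z)
    (cx : c * x = c + x + y) (cy : c * y = c + x + y) (xy : x * y = c + x + y)
    (f : A →ₗ[k] k) (fa : f a = 0) (fb : f b = 0) (fc : f c = 1) (fx : f x = 0) (fy : f y = 0)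
    (fz : f z = 0)
    (h₀ : EigenFusion (a + b + c)) (h₁ : EigenFusion (a + y + z)) (h₂ : EigenFusion (b + x + z)) :
    ScalingFrame k A :=
  have h2' : ∀ u v : A, u + (u + v) = v := fun u v => by rw [← add_assoc, h2, zero_add]
  have ba := mul_comm b a ▸ ab
  have ca := mul_comm c a ▸ ac
  have cb := mul_comm c b ▸ bc
  have ya := mul_comm y a ▸ ay
  have za := mul_comm z a ▸ az
  have zy := mul_comm z y ▸ yz
  have xb := mul_comm x b ▸ bx
  have zb := mul_comm z b ▸ bz
  have zx := mul_comm z x ▸ xz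
  have xc := mul_comm x c ▸ cx
  have yc := mul_comm y c ▸ cy
  have yx := mul_comm y x ▸ xy
  have xa := mul_comm x a ▸ ax
  have yb := mul_comm y b ▸ bY
  have zc := mul_comm z c ▸ cz
  -- The repeated `a` cancels in characteristic 2. Writing `v₁` (and below `v₂`) as a sum of two
  -- line nilpotents transfers to it their derivation property and their values in the plane.
  have e₁ : b + c + y + z = (a + b + c) + (a + y + z) := by
    simp only [add_comm, add_left_comm, h2', h2]
  have e₂ : a + c + x + z = (a + b + c) + (b + x + z) := by
    simp only [add_comm, add_left_comm, h2', h2]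
  have m₁ : b + c + y + z ∈ Submodule.span k {b + c + y + z, a + c + x + z} :=
    Submodule.subset_span (by simp)
  have m₂ : a + c + x + z ∈ Submodule.span k {b + c + y + z, a + c + x + z} :=
    Submodule.subset_span (by simp)
  -- A line nilpotent kills the three points of its line and sends the other three to nonzero sums
  -- of `v₁` and `v₂`, so four possible values suffice on the basis points.
  have mem : ∀ w : A,
      (∀ u ∈ ({a, b, c, x, y, z} : Set A), w * u = 0 ∨ w * u = b + c + y + z ∨
        w * u = a + c + x + z ∨ w * u = (b + c + y + z) + (a + c + x + z)) →
      ∀ u, w * u ∈ Submodule.span k {b + c + y + z, a + c + x + z} := by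
    intro w hw u
    have hu : u ∈ Submodule.span k {a, b, c, x, y, z} := hspan ▸ Submodule.mem_top
    induction hu using Submodule.span_induction with
    | mem u hu =>
      rcases hw u hu with h | h | h | h <;> rw [h]
      exacts [zero_mem _, m₁, m₂, add_mem m₁ m₂]
    | zero => rw [mul_zero]; exact zero_mem _
    | add u v _ _ hu hv => rw [mul_add]; exact add_mem hu hv
    | smul r u _ hu => rw [mul_smul_comm]; exact Submodule.smul_mem _ _ hu
  have s_mem : ∀ u, (a + b + c) * u ∈ Submodule.span k {b + c + y + z, a + c + x + z} :=
    mem _ <| by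
      simp only [Set.mem_insert_iff, Set.mem_singleton_iff, forall_eq_or_imp, forall_eq, add_mul,
        aa, ab, ac, ax, ay, az, ba, bb, bc, bx, bY, bz, ca, cb, cc, cx, cy, cz, zero_add, add_zero,
        add_comm, add_left_comm, h2, h2', true_or, or_true, and_self]
  have s₁_mem : ∀ u, (a + y + z) * u ∈ Submodule.span k {b + c + y + z, a + c + x + z} :=
    mem _ <| by
      simp only [Set.mem_insert_iff, Set.mem_singleton_iff, forall_eq_or_imp, forall_eq, add_mul,
        aa, ab, ac, ax, ay, az, ya, yb, yc, yx, yy, yz, za, zb, zc, zx, zy, zz, zero_add, add_zero,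
        add_comm, add_left_comm, h2, h2', true_or, or_true, and_self]
  have s₂_mem : ∀ u, (b + x + z) * u ∈ Submodule.span k {b + c + y + z, a + c + x + z} :=
    mem _ <| by
      simp only [Set.mem_insert_iff, Set.mem_singleton_iff, forall_eq_or_imp, forall_eq, add_mul,
        ba, bb, bc, bx, bY, bz, xa, xb, xc, xx, xy, xz, za, zb, zc, zx, zy, zz, zero_add, add_zero,
        add_comm, add_left_comm, h2, h2', true_or, or_true, and_self]
  have der : ∀ w w' : A, EigenFusion w → EigenFusion w' → ∀ u v,
      (w + w') * (u * v) = (w + w') * u * v + u * ((w + w') * v) := by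
    intro w w' hw hw' u v
    simp only [add_mul, mul_add, hw.zero_zero, hw'.zero_zero]
    abel
  have s_v₁ : (a + b + c) * (b + c + y + z) = b + c + y + z := by
    simp only [add_mul, mul_add, aa, ab, ac, ay, az, ba, bb, bc, bY, bz, ca, cb, cc, cy, cz,
      zero_add, add_zero, add_comm, add_left_comm, h2, h2']
  have s_v₂ : (a + b + c) * (a + c + x + z) = a + c + x + z := by
    simp only [add_mul, mul_add, aa, ab, ac, ax, az, ba, bb, bc, bx, bz, ca, cb, cc, cx, cz,
      zero_add, add_zero, add_comm, add_left_comm, h2, h2']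
  -- Both plane generators are eigenvectors of `s` for the eigenvalue `1`, and the fusion law makes
  -- products within that eigenspace vanish.
  have zero : ∀ {u v : A}, (a + b + c) * u = u → (a + b + c) * v = v → u * v = 0 :=
    fun hu hv => by rw [← hu, ← hv, h₀.one_one]
  have v₁_a : (b + c + y + z) * a = 0 := by
    simp only [add_mul, ba, ca, ya, za, add_comm, add_left_comm, h2, h2']
  have v₂_a : (a + c + x + z) * a = b + c + y + z := by
    simp only [add_mul, aa, ca, xa, za, zero_add, add_zero, add_comm, add_left_comm, h2, h2']
  have v₁_b : (b + c + y + z) * b = a + c + x + z := by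
    simp only [add_mul, bb, cb, yb, zb, zero_add, add_zero, add_comm, add_left_comm, h2, h2']
  have v₂_b : (a + c + x + z) * b = 0 := by
    simp only [add_mul, ab, cb, xb, zb, add_comm, add_left_comm, h2, h2']
  { s := a + b + c
    v₁ := b + c + y + z
    v₂ := a + c + x + z
    p := a
    q := b
    -- Multiplication by `b` sends `v₁` to `v₂` and kills `v₂`; by `a`, it sends `v₂` to `v₁` and
    -- kills `v₁`. The functional `f` takes the value `1` on both `v₁` and `v₂`. Factoring through a
    -- multiplication makes both functionals vanish on the annihilator, so that the frame descends.
    f₁ := f ∘ₗ LinearMap.mulRight k b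
    f₂ := f ∘ₗ LinearMap.mulRight k a
    s_mul_mem := s_mem
    v₁_mul_mem u := by
      have h := add_mem (s_mem u) (s₁_mem u)
      rwa [← add_mul, ← e₁] at h
    v₂_mul_mem u := by
      have h := add_mem (s_mem u) (s₂_mem u)
      rwa [← add_mul, ← e₂] at h
    s_mul_mul := h₀.zero_zero
    v₁_mul_mul := e₁ ▸ der _ _ h₀ h₁
    v₂_mul_mul := e₂ ▸ der _ _ h₀ h₂
    s_mul_v₁ := s_v₁
    s_mul_v₂ := s_v₂
    v₁_mul_v₁ := zero s_v₁ s_v₁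
    v₁_mul_v₂ := zero s_v₁ s_v₂
    v₂_mul_v₁ := zero s_v₂ s_v₁
    v₂_mul_v₂ := zero s_v₂ s_v₂
    s_mul_p := by simp only [add_mul, aa, ba, ca, zero_add, h2]
    v₁_mul_p := v₁_a
    v₂_mul_p := v₂_a
    s_mul_q := by simp only [add_mul, bb, ab, cb, add_zero, h2]
    v₁_mul_q := v₁_b
    v₂_mul_q := v₂_b
    f₁_v₁ := by simp [v₁_b, fa, fc, fx, fz]
    f₁_v₂ := by simp [v₂_b]
    f₂_v₁ := by simp [v₁_a]
    f₂_v₂ := by simp [v₂_a, fb, fc, fy, fz] }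

end Table

/-! ### The points and lines of the quadrilateral, and its four line nilpotents in terms of the
frame. -/

section Quadrilateral

/-- The line through the transpositions `(i j)`, `(i l)`, `(j l)`. -/
def quadLine (i j l : Fin 4) (hij : i ≠ j) (hil : i ≠ l) (hjl : j ≠ l) : quadrilateral.lines := by
  classical
  exact ⟨{tr i j hij, tr i l hil, tr j l hjl}, _, _, _, tr_isSymTriple hij hil hjl,
    fun t => by simp⟩

theorem quadLine_cases (l : quadrilateral.lines) :
    l = quadLine 0 1 2 (by decide) (by decide) (by decide) ∨
    l = quadLine 0 1 3 (by decide) (by decide) (by decide) ∨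
    l = quadLine 0 2 3 (by decide) (by decide) (by decide) ∨
    l = quadLine 1 2 3 (by decide) (by decide) (by decide) := by
  obtain ⟨l, hl⟩ := l
  obtain ⟨p, q, r, hpq, hpr, hqr, h⟩ := exists_labels l hl
  have key : ∀ p q r : Fin 4, p ≠ q → p ≠ r → q ≠ r →
      ({.swap p q, .swap p r, .swap q r} : Finset (Equiv.Perm (Fin 4))) =
        {.swap 0 1, .swap 0 2, .swap 1 2} ∨
      ({.swap p q, .swap p r, .swap q r} : Finset (Equiv.Perm (Fin 4))) =
        {.swap 0 1, .swap 0 3, .swap 1 3} ∨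
      ({.swap p q, .swap p r, .swap q r} : Finset (Equiv.Perm (Fin 4))) =
        {.swap 0 2, .swap 0 3, .swap 2 3} ∨
      ({.swap p q, .swap p r, .swap q r} : Finset (Equiv.Perm (Fin 4))) =
        {.swap 1 2, .swap 1 3, .swap 2 3} := by
    decide
  classical
  refine (key p q r hpq hpr hqr).imp ?_ (Or.imp ?_ (Or.imp ?_ ?_)) <;>
  · intro H
    refine Subtype.ext (Finset.ext fun t => ?_)
    rw [h]
    simpa [quadLine, tr, Subtype.ext_iff] using Finset.ext_iff.1 H t.1

variable (k : Type u) [Field k]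

/-- The point `(i j)` of the complete quadrilateral, as an element of the algebra. -/
def pt (i j : Fin 4) (h : i ≠ j) : QuadAlg k := Matsuo.basis quadrilateral k 1 (tr i j h)

theorem lineSum_quadLine (i j l : Fin 4) (hij : i ≠ j) (hil : i ≠ l) (hjl : j ≠ l) :
    Matsuo.lineSum quadrilateral k 1 (quadLine i j l hij hil hjl).1 =
      pt k i j hij + pt k i l hil + pt k j l hjl := by
  classical
  obtain ⟨-, -, h1, h2, h3⟩ := (tr_isSymTriple hij hil hjl).rotate
    (isThreeTranspositionGroup_transpositions.involution _ (Subtype.prop _))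
    (isThreeTranspositionGroup_transpositions.involution _ (Subtype.prop _))
  have h : (quadLine i j l hij hil hjl).1 = {tr i j hij, tr i l hil, tr j l hjl} := by
    ext t
    simp [quadLine]
  rw [Matsuo.lineSum, h, Finset.sum_insert, Finset.sum_insert, Finset.sum_singleton, add_assoc]
  · rfl
  · simpa using fun h => h3 (congrArg Subtype.val h).symm
  · simpa using ⟨fun h => h1 (congrArg Subtype.val h), fun h => h2 (congrArg Subtype.val h).symm⟩

theorem pt_comm (i j : Fin 4) (h : i ≠ j) : pt k i j h = pt k j i h.symm :=
  congrArg (Matsuo.basis quadrilateral k 1) (Subtype.ext (Equiv.swap_comm i j))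

theorem pt_mul_self (i j : Fin 4) (h : i ≠ j) : pt k i j h * pt k i j h = 0 := by
  rw [pt, Matsuo.basis_mul_basis, Matsuo.pointMul, if_neg fun h => h.1 rfl]

theorem pt_mul_pt_of_disjoint {i j l m : Fin 4} (hij : i ≠ j) (hlm : l ≠ m) (h1 : i ≠ l)
    (h2 : i ≠ m) (h3 : j ≠ l) (h4 : j ≠ m) : pt k i j hij * pt k l m hlm = 0 :=
  fischerSpace_mul_eq_zero _ k (tr_mul_tr hij hlm h1 h2 h3 h4)

theorem pt_mul_pt {i j l : Fin 4} (hij : i ≠ j) (hil : i ≠ l) (hjl : j ≠ l) :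
    pt k i j hij * pt k i l hil = pt k i j hij + pt k i l hil + pt k j l hjl ∧
    pt k i j hij * pt k j l hjl = pt k i j hij + pt k i l hil + pt k j l hjl ∧
    pt k i l hil * pt k j l hjl = pt k i j hij + pt k i l hil + pt k j l hjl := by
  have line : ∀ {i j l : Fin 4} (hij : i ≠ j) (hil : i ≠ l) (hjl : j ≠ l),
      pt k i j hij * pt k i l hil = pt k i j hij + pt k i l hil + pt k j l hjl :=
    fun hij hil hjl => fischerSpace_mul _ k (tr_isSymTriple hij hil hjl)
  refine ⟨line hij hil hjl, ?_, ?_⟩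
  · rw [pt_comm k i j, line hij.symm hjl hil]; abel
  · rw [pt_comm k i l, pt_comm k j l, line hil.symm hjl.symm hij]; abel

theorem span_pt :
    Submodule.span k {pt k 0 1 (by decide), pt k 0 2 (by decide), pt k 1 2 (by decide),
      pt k 2 3 (by decide), pt k 1 3 (by decide), pt k 0 3 (by decide)} = ⊤ := by
  rw [eq_top_iff, ← (Matsuo.basis quadrilateral k 1).span_eq, Submodule.span_le]
  rintro _ ⟨⟨_, i, j, hij, rfl⟩, rfl⟩
  apply Submodule.subset_span
  change pt k i j hij ∈ _
  simp only [Set.mem_insert_iff, Set.mem_singleton_iff]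
  have hall : ∀ t : Fin 4, t = 0 ∨ t = 1 ∨ t = 2 ∨ t = 3 := by decide
  rcases hall i with rfl | rfl | rfl | rfl <;> rcases hall j with rfl | rfl | rfl | rfl <;> first
    | exact absurd rfl hij
    | simp
    | (rw [pt_comm]; simp)

variable [CharP k 2]

theorem eigenFusion_pt (i j l : Fin 4) (hij : i ≠ j) (hil : i ≠ l) (hjl : j ≠ l) :
    EigenFusion (pt k i j hij + pt k i l hil + pt k j l hjl) :=
  lineSum_quadLine k i j l hij hil hjl ▸ eigenFusion_lineSum k _ (quadLine i j l hij hil hjl).2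

theorem quadAlg_add_self (u : QuadAlg k) : u + u = 0 := by
  rw [← two_smul k u, CharTwo.two_eq_zero, zero_smul]

/-- The scaling frame of the nilpotent Matsuo algebra of the complete quadrilateral. -/
def quadFrame : ScalingFrame k (QuadAlg k) :=
  have l₀ := pt_mul_pt k (i := 0) (j := 1) (l := 2) (by decide) (by decide) (by decide)
  have l₁ := pt_mul_pt k (i := 0) (j := 1) (l := 3) (by decide) (by decide) (by decide)
  have l₂ := pt_mul_pt k (i := 0) (j := 2) (l := 3) (by decide) (by decide) (by decide)
  have l₃ := pt_mul_pt k (i := 1) (j := 2) (l := 3) (by decide) (by decide) (by decide)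
  -- The functional `f` is the coordinate at the point `(1 2)`, which plays the role of `c` in the
  -- table.
  have hf : ∀ (i j : Fin 4) (h : i ≠ j), Equiv.swap i j ≠ Equiv.swap 1 2 →
      (Matsuo.basis quadrilateral k 1).coord (tr 1 2 (by decide)) (pt k i j h) = 0 := by
    intro i j h hne
    rw [pt, Module.Basis.coord_apply, Module.Basis.repr_self, Finsupp.single_eq_of_ne]
    exact fun h => hne (congrArg Subtype.val h).symm
  ScalingFrame.ofTable (quadAlg_add_self k) (pt k 0 1 (by decide)) (pt k 0 2 (by decide))
    (pt k 1 2 (by decide)) (pt k 2 3 (by decide)) (pt k 1 3 (by decide)) (pt k 0 3 (by decide))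
    (span_pt k) (pt_mul_self ..) (pt_mul_self ..) (pt_mul_self ..) (pt_mul_self ..)
    (pt_mul_self ..) (pt_mul_self ..)
    (pt_mul_pt_of_disjoint k _ _ (by decide) (by decide) (by decide) (by decide))
    (pt_mul_pt_of_disjoint k _ _ (by decide) (by decide) (by decide) (by decide))
    (pt_mul_pt_of_disjoint k _ _ (by decide) (by decide) (by decide) (by decide))
    l₀.1 l₀.2.1 l₀.2.2
    (by rw [l₁.2.1]; abel) (by rw [l₁.1]; abel) (by rw [mul_comm, l₁.2.2]; abel)
    (by rw [l₂.2.1]; abel) (by rw [l₂.1]; abel) (by rw [mul_comm, l₂.2.2]; abel)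
    (by rw [l₃.2.1]; abel) (by rw [l₃.1]; abel) (by rw [mul_comm, l₃.2.2]; abel)
    ((Matsuo.basis quadrilateral k 1).coord (tr 1 2 (by decide)))
    (hf _ _ _ (by decide)) (hf _ _ _ (by decide))
    (by rw [pt, Module.Basis.coord_apply, Module.Basis.repr_self, Finsupp.single_eq_same])
    (hf _ _ _ (by decide)) (hf _ _ _ (by decide)) (hf _ _ _ (by decide))
    (eigenFusion_pt k 0 1 2 _ _ _)
    (add_right_comm (pt k 0 1 _) _ _ ▸ eigenFusion_pt k 0 1 3 (by decide) (by decide) (by decide))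
    (add_right_comm (pt k 0 2 _) _ _ ▸ eigenFusion_pt k 0 2 3 (by decide) (by decide) (by decide))

/-- The functional is evaluated on a product with `u`, which is zero for `u` in the annihilator. -/
theorem annihilator_le_ker_f₁ :
    annihilator k (QuadAlg k) ≤ LinearMap.ker (quadFrame k).f₁ := fun u hu => by
  change Module.Basis.coord _ _ (u * _) = 0
  rw [hu, map_zero]

theorem annihilator_le_ker_f₂ :
    annihilator k (QuadAlg k) ≤ LinearMap.ker (quadFrame k).f₂ := fun u hu => by
  change Module.Basis.coord _ _ (u * _) = 0
  rw [hu, map_zero]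

theorem quadFrame_elt (b c : k) :
    (quadFrame k).elt 1 b c =
      pt k 0 1 (by decide) + pt k 0 2 (by decide) + pt k 1 2 (by decide) +
      b • (pt k 0 2 (by decide) + pt k 1 2 (by decide) + pt k 1 3 (by decide) +
        pt k 0 3 (by decide)) +
      c • (pt k 0 1 (by decide) + pt k 1 2 (by decide) + pt k 2 3 (by decide) +
        pt k 0 3 (by decide)) :=
  congrArg (fun u => u + _ + _) (one_smul k _)

theorem lineSum_eq_elt_zero_zero :
    Matsuo.lineSum quadrilateral k 1 (quadLine 0 1 2 (by decide) (by decide) (by decide)).1 =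
      (quadFrame k).elt 1 0 0 := by
  rw [lineSum_quadLine, quadFrame_elt, zero_smul, zero_smul, add_zero, add_zero]

theorem lineSum_eq_elt_one_zero :
    Matsuo.lineSum quadrilateral k 1 (quadLine 0 1 3 (by decide) (by decide) (by decide)).1 =
      (quadFrame k).elt 1 1 0 := by
  have h2' : ∀ u v : QuadAlg k, u + (u + v) = v := fun u v => by
    rw [← add_assoc, quadAlg_add_self, zero_add]
  rw [lineSum_quadLine, quadFrame_elt, zero_smul, one_smul, add_zero]
  have h2 := quadAlg_add_self k
  generalize pt k 0 1 _ = a, pt k 0 2 _ = b, pt k 1 2 _ = c, pt k 2 3 _ = x, pt k 1 3 _ = y,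
    pt k 0 3 _ = z
  simp only [add_comm, add_left_comm, h2', h2]

theorem lineSum_eq_elt_zero_one :
    Matsuo.lineSum quadrilateral k 1 (quadLine 0 2 3 (by decide) (by decide) (by decide)).1 =
      (quadFrame k).elt 1 0 1 := by
  have h2' : ∀ u v : QuadAlg k, u + (u + v) = v := fun u v => by
    rw [← add_assoc, quadAlg_add_self, zero_add]
  rw [lineSum_quadLine, quadFrame_elt, zero_smul, one_smul, add_zero]
  have h2 := quadAlg_add_self k
  generalize pt k 0 1 _ = a, pt k 0 2 _ = b, pt k 1 2 _ = c, pt k 2 3 _ = x, pt k 1 3 _ = y,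
    pt k 0 3 _ = z
  simp only [add_comm, add_left_comm, h2', h2]

/-- In `s + v₁ + v₂` each point outside this line occurs an even number of times, and those on it an
odd number. -/
theorem lineSum_eq_elt_one_one :
    Matsuo.lineSum quadrilateral k 1 (quadLine 1 2 3 (by decide) (by decide) (by decide)).1 =
      (quadFrame k).elt 1 1 1 := by
  have h2' : ∀ u v : QuadAlg k, u + (u + v) = v := fun u v => by
    rw [← add_assoc, quadAlg_add_self, zero_add]
  rw [lineSum_quadLine, quadFrame_elt, one_smul, one_smul]
  have h2 := quadAlg_add_self k
  generalize pt k 0 1 _ = a, pt k 0 2 _ = b, pt k 1 2 _ = c, pt k 2 3 _ = x, pt k 1 3 _ = y,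
    pt k 0 3 _ = z
  simp only [add_comm, add_left_comm, h2', h2, add_zero]

theorem exists_lineSum_eq_elt (l : quadrilateral.lines) :
    ∃ b c : k, Matsuo.lineSum quadrilateral k 1 l.1 = (quadFrame k).elt 1 b c := by
  rcases quadLine_cases l with rfl | rfl | rfl | rfl
  exacts [⟨_, _, lineSum_eq_elt_zero_zero k⟩, ⟨_, _, lineSum_eq_elt_one_zero k⟩,
    ⟨_, _, lineSum_eq_elt_zero_one k⟩, ⟨_, _, lineSum_eq_elt_one_one k⟩]

/-- The Miyamoto group of the nilpotent Matsuo algebra of the complete quadrilateral. -/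
theorem nonempty_miyamotoGroup_quadDecomposition_iso :
    Nonempty (miyamotoGroup (quadDecomposition k) ≅ gaSqGm k) :=
  (quadFrame k).nonempty_miyamotoGroup_iso _ (exists_lineSum_eq_elt k)
    (lineSum_eq_elt_zero_zero k) (lineSum_eq_elt_one_zero k) (lineSum_eq_elt_zero_one k)

/-- The Miyamoto group of the reduced nilpotent Matsuo algebra of the complete quadrilateral. -/
theorem nonempty_miyamotoGroup_quadDecomposition'_iso :
    Nonempty (miyamotoGroup (quadDecomposition' k) ≅ gaSqGm k) := by
  have h : ∀ {l : Finset transpositions} {b c : k},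
      Matsuo.lineSum quadrilateral k 1 l = (quadFrame k).elt 1 b c →
      Reduced.mk k (QuadAlg k) (Matsuo.lineSum quadrilateral k 1 l) =
        ((quadFrame k).reduced (annihilator_le_ker_f₁ k) (annihilator_le_ker_f₂ k)).elt 1 b c :=
    fun h => by rw [h, ScalingFrame.reduced_elt]
  refine ScalingFrame.nonempty_miyamotoGroup_iso _ _ (fun l => ?_)
    (h (lineSum_eq_elt_zero_zero k)) (h (lineSum_eq_elt_one_zero k)) (h (lineSum_eq_elt_zero_one k))
  obtain ⟨b, c, hl⟩ := exists_lineSum_eq_elt k l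
  exact ⟨b, c, h hl⟩

end Quadrilateral

end NilpotentMatsuo

end

theorem mainTheorem3 (k : Type u) [Field k] [CharP k 2] :
    Nonempty (NilpotentMatsuo.miyamotoGroup (NilpotentMatsuo.quadDecomposition k) ≅
        NilpotentMatsuo.miyamotoGroup (NilpotentMatsuo.quadDecomposition' k)) ∧
      Nonempty (NilpotentMatsuo.miyamotoGroup (NilpotentMatsuo.quadDecomposition k) ≅
        NilpotentMatsuo.gaSqGm k) ∧
      Nonempty (NilpotentMatsuo.miyamotoGroup (NilpotentMatsuo.quadDecomposition' k) ≅
        NilpotentMatsuo.gaSqGm k) := by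
  obtain ⟨e⟩ := NilpotentMatsuo.nonempty_miyamotoGroup_quadDecomposition_iso k
  obtain ⟨e'⟩ := NilpotentMatsuo.nonempty_miyamotoGroup_quadDecomposition'_iso k
  exact ⟨⟨e ≪≫ e'.symm⟩, ⟨e⟩, ⟨e'⟩⟩
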